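/- **Setting.** Let $n\ge 1$. On $\mathbb{R}^{2n}\ni z=(x,y)$ with the standard inner product let $J_0(x,y)=(-y,x)$, $\tau_0(x,y)=(x,-y)$ and $L_0=\mathrm{Fix}(\tau_0)=\{y=0\}$. Let $\mathbb{E}=E^{1/2}_{\tau_0}$ be the Hilbert space of all $x=\sum_{j\in\mathbb{Z}}e^{2\pi jtJ_0}x_j\in L^2(\mathbb{R}/\mathbb{Z};\mathbb{R}^{2n})$ with $x_j\in L_0$ and $\sum_j|j||x_j|^2<\infty$, with inner product $\langle x,y\rangle_{1/2}=\langle x_0,y_0\rangle+\sum_j|2\pi j|\langle x_j,y_j\rangle$. Let $\mathbb{E}=\mathbb{E}^-\oplus\mathbb{E}^0\oplus\mathbb{E}^+$, $x=x^-+x^0+x^+$, be the orthogonal splitting into the parts with $j<0$, $j=0$, $j>0$, and let $S^+$ be the unit sphere of $\mathbb{E}^+$. For $H:\mathbb{R}^{2n}\to[0,\infty)$ put $$\Phi_H(x)=\tfrac12\left(\|x^+\|_{1/2}^2-\|x^-\|_{1/2}^2\right)-\int_0^1H(x(t))\,dt,\qquad x\in\mathbb{E}.$$ Let $\Gamma$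 be the set of continuous maps $\gamma:\mathbb{E}\to\mathbb{E}$ for which there is a homotopy $(\gamma_u)_{0\le u\le1}$ with $\gamma_0=\mathrm{id}$, $\gamma_1=\gamma$, such that (i) $\gamma_u(\mathbb{E}\setminus(\mathbb{E}^-\oplus\mathbb{E}^0))=\mathbb{E}\setminus(\mathbb{E}^-\oplus\mathbb{E}^0)$ for all $u\in[0,1]$; (ii) $\gamma_u(x)=a(x,u)x^++b(x,u)x^0+c(x,u)x^-+K(x,u)$, where $(a,b,c,K):\mathbb{E}\times[0,1]\to(0,\infty)^3\times\mathbb{E}$ is continuous and maps bounded sets to relatively compact subsets of $(0,\infty)^3\times\mathbb{E}$. Put $$c_{\mathrm{EH},\tau_0}(H)=\sup_{\gamma\in\Gamma}\ \inf_{x\in\gamma(S^+)}\Phi_H(x)\in[-\infty,\infty].$$ **Theorem 3.1.** Let $H\in C^\infty(\mathbb{R}^{2n},\mathbb{R})$ with $H\ge0$ satisfy (H1) $H(z)=H(\tau_0z)$ for all $z\in\mathbb{R}^{2n}$; (H2) $\mathrm{Int}(H^{-1}(0))\cap L_0\neq\emptyset$; (H3) there are $z_0\in L_0$ and real numbers $a>2\pi$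 and $b$ such that $H(z)=a|z|^2+\langle z,z_0\rangle+b$ outside a compact subset of $\mathbb{R}^{2n}$; and let $H$ be nonresonant, that is, (H3) holds with some $a\notin\mathbb{Z}\pi$. Then $c_{\mathrm{EH},\tau_0}(H)$ is a (finite) positive critical value of $\Phi_H$ on $\mathbb{E}$: $0<c_{\mathrm{EH},\tau_0}(H)<\infty$, and there is $x\in\mathbb{E}$ at which $\Phi_H$ is Fréchet differentiable with $d\Phi_H(x)=0$ and $\Phi_H(x)=c_{\mathrm{EH},\tau_0}(H)$. -/

import Mathlib

open MeasureTheory Set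
open scoped ContDiff InnerProductSpace

noncomputable section

namespace SymEH

/-- `ℝ²ⁿ` with its standard inner product; `z (Sum.inl i)` is the coordinate `x_i` and
`z (Sum.inr i)` is the coordinate `y_i` of `z = (x, y)`. -/
abbrev Phase (n : ℕ) : Type := EuclideanSpace ℝ (Fin n ⊕ Fin n)

/-- The standard complex structure `J₀ (x, y) = (-y, x)`. -/
def J0 (n : ℕ) : Phase n →ₗ[ℝ] Phase n where
  toFun z := WithLp.toLp 2 (Sum.elim (fun i => -z (Sum.inr i)) (fun i => z (Sum.inl i)))
  map_add' z w := by
    ext i; rcases i with i | i <;> simp; ring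
  map_smul' r z := by
    ext i; rcases i with i | i <;> simp

/-- The canonical anti-symplectic involution `τ₀ (x, y) = (x, -y)`. -/
def tau0 (n : ℕ) : Phase n →ₗ[ℝ] Phase n where
  toFun z := WithLp.toLp 2 (Sum.elim (fun i => z (Sum.inl i)) (fun i => -z (Sum.inr i)))
  map_add' z w := by
    ext i; rcases i with i | i <;> simp; ring
  map_smul' r z := by
    ext i; rcases i with i | i <;> simp

/-- `L₀ = Fix τ₀`. -/
def L0 (n : ℕ) : Submodule ℝ (Phase n) := LinearMap.eqLocus (tau0 n) LinearMap.id

/-- The Hilbert space `L²(S¹; ℝ²ⁿ)`, where `S¹ = ℝ/ℤ` carries Lebesgue measure. -/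
abbrev L2Loop (n : ℕ) : Type := Lp (Phase n) 2 (volume : Measure UnitAddCircle)

/-- The rotation `e^{2πjtJ₀} = cos(2πjt) + sin(2πjt) J₀` of `ℝ²ⁿ`, for `t ∈ ℝ/ℤ`. -/
def rot (n : ℕ) (j : ℤ) (t : UnitAddCircle) (v : Phase n) : Phase n :=
  (fourier j t : ℂ).re • v + (fourier j t : ℂ).im • J0 n v

theorem continuous_rot (n : ℕ) (j : ℤ) (v : Phase n) : Continuous fun t => rot n j t v := by
  unfold rot
  have h : Continuous fun t : UnitAddCircle => (fourier j t : ℂ) := (fourier j).continuous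
  exact ((Complex.continuous_re.comp h).smul continuous_const).add
    ((Complex.continuous_im.comp h).smul continuous_const)

/-- The loop `t ↦ e^{2πjtJ₀} v` as an element of `L²(S¹; ℝ²ⁿ)`. -/
def mode (n : ℕ) (j : ℤ) : Phase n →ₗ[ℝ] L2Loop n where
  toFun v := ContinuousMap.toLp 2 volume ℝ ⟨fun t => rot n j t v, continuous_rot n j v⟩
  map_add' v w := by
    rw [← map_add]; congr 1; ext1 t; simp [rot]; abel
  map_smul' r v := by
    rw [← map_smul]; congr 1; ext1 t; simp [rot, smul_comm r]

/-- The `j`-th coefficient `x_j = ∫₀¹ e^{-2πjtJ₀} x(t) dt` of `x ∈ L²(S¹; ℝ²ⁿ)`. -/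
def coeff {n : ℕ} (x : L2Loop n) (j : ℤ) : Phase n := ∫ t, rot n (-j) t (x t)

theorem inner_J0_left {n : ℕ} (v w : Phase n) : ⟪J0 n v, w⟫_ℝ = -⟪v, J0 n w⟫_ℝ := by
  simp only [PiLp.inner_apply, Fintype.sum_sum_type, J0, LinearMap.coe_mk, AddHom.coe_mk,
    Sum.elim_inl, Sum.elim_inr, neg_add, ← Finset.sum_neg_distrib]
  rw [add_comm]
  simp

theorem inner_rot {n : ℕ} (j : ℤ) (t : UnitAddCircle) (v w : Phase n) :
    ⟪v, rot n (-j) t w⟫_ℝ = ⟪rot n j t v, w⟫_ℝ := by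
  simp only [rot, fourier_neg, inner_add_left, inner_add_right, inner_smul_left,
    inner_smul_right, inner_J0_left, Complex.conj_re, Complex.conj_im]
  simp

theorem J0_J0 {n : ℕ} (v : Phase n) : J0 n (J0 n v) = -v := by
  ext i; rcases i with i | i <;> simp [J0]

theorem rot_rot {n : ℕ} (j k : ℤ) (t : UnitAddCircle) (v : Phase n) :
    rot n j t (rot n k t v) = rot n (j + k) t v := by
  simp only [rot, fourier_add, map_add, map_smul, J0_J0, Complex.mul_re, Complex.mul_im]
  module

theorem integrable_rot {n : ℕ} (x : L2Loop n) (j : ℤ) :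
    Integrable (fun t => rot n j t (x t)) volume := by
  have hx : Integrable (x : UnitAddCircle → Phase n) volume :=
    (Lp.memLp x).integrable (by norm_num)
  have hc : Continuous fun t : UnitAddCircle => (fourier j t : ℂ) := (fourier j).continuous
  have hJ : Integrable (fun t => J0 n (x t)) volume :=
    (LinearMap.toContinuousLinearMap (J0 n)).integrable_comp hx
  have hn : ∀ t : UnitAddCircle, ‖(fourier j t : ℂ)‖ ≤ 1 := fun t => by
    rw [fourier_apply]; exact (Circle.norm_coe _).le
  unfold rot
  refine Integrable.add ?_ ?_
  · refine hx.bdd_smul (φ := fun t : UnitAddCircle => (fourier j t : ℂ).re) 1 (Complex.continuous_re.comp hc).aestronglyMeasurable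
      (Filter.Eventually.of_forall fun t => (Complex.abs_re_le_norm _).trans (hn t))
  · refine hJ.bdd_smul (φ := fun t : UnitAddCircle => (fourier j t : ℂ).im) 1 (Complex.continuous_im.comp hc).aestronglyMeasurable
      (Filter.Eventually.of_forall fun t => (Complex.abs_im_le_norm _).trans (hn t))

theorem mode_coeFn (n : ℕ) (j : ℤ) (v : Phase n) :
    (mode n j v : UnitAddCircle → Phase n) =ᵐ[volume] fun t => rot n j t v :=
  ContinuousMap.coeFn_toLp (𝕜 := ℝ) volume
    (⟨fun t => rot n j t v, continuous_rot n j v⟩ : C(UnitAddCircle, Phase n))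

theorem inner_coeff {n : ℕ} (x : L2Loop n) (j : ℤ) (v : Phase n) :
    ⟪v, coeff x j⟫_ℝ = ⟪mode n j v, x⟫_ℝ := by
  rw [coeff, ← integral_inner (integrable_rot x (-j)), L2.inner_def]
  refine integral_congr_ae ?_
  filter_upwards [mode_coeFn n j v] with t ht
  rw [ht, inner_rot]

theorem integral_fourier (j : ℤ) :
    ∫ t : UnitAddCircle, (fourier j t : ℂ) = if j = 0 then 1 else 0 := by
  have h := fourierCoeff_fourier (T := (1 : ℝ)) j
  have h0 := congrFun h 0
  rw [fourierCoeff, AddCircle.integral_haarAddCircle] at h0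
  simp only [neg_zero, fourier_zero, one_smul, inv_one] at h0
  refine h0.trans ?_
  by_cases hj : j = 0
  · subst hj; simp
  · rw [if_neg hj, Pi.single_eq_of_ne (fun h => hj h.symm)]

theorem coeff_mode {n : ℕ} (j k : ℤ) (v : Phase n) :
    coeff (mode n k v) j = if k = j then v else 0 := by
  have h1 : coeff (mode n k v) j = ∫ t, rot n (-j + k) t v := by
    refine integral_congr_ae ?_
    filter_upwards [mode_coeFn n k v] with t ht
    rw [ht, rot_rot]
  have hF : Integrable (fun t : UnitAddCircle => (fourier (-j + k) t : ℂ)) volume :=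
    (fourier (-j + k)).continuous.integrable_of_hasCompactSupport
      (HasCompactSupport.of_compactSpace _)
  rw [h1]
  simp only [rot]
  have e1 : ∫ t : UnitAddCircle, (fourier (-j + k) t : ℂ).re
      = (∫ t : UnitAddCircle, (fourier (-j + k) t : ℂ)).re :=
    integral_re (𝕜 := ℂ) hF
  have e2 : ∫ t : UnitAddCircle, (fourier (-j + k) t : ℂ).im
      = (∫ t : UnitAddCircle, (fourier (-j + k) t : ℂ)).im :=
    integral_im (𝕜 := ℂ) hF
  have i1 : Integrable (fun t : UnitAddCircle => (fourier (-j + k) t : ℂ).re) volume := hF.re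
  have i2 : Integrable (fun t : UnitAddCircle => (fourier (-j + k) t : ℂ).im) volume := hF.im
  rw [integral_add (i1.smul_const _) (i2.smul_const _), integral_smul_const,
    integral_smul_const, e1, e2, integral_fourier]
  by_cases hkj : k = j
  · subst hkj; simp
  · have : -j + k ≠ 0 := fun h => hkj (by omega)
    simp [hkj, this]

/-- The coefficients of a series `∑ e^{2πjtJ₀} c_j` converging in `L²` are the `c_j`. -/
theorem coeff_eq_of_hasSum {n : ℕ} {x : L2Loop n} {c : ℤ → Phase n}
    (h : HasSum (fun j => mode n j (c j)) x) : coeff x = c := by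
  funext j
  refine ext_inner_left ℝ fun v => ?_
  rw [inner_coeff]
  have h1 : HasSum (fun k => ⟪mode n j v, mode n k (c k)⟫_ℝ) ⟪mode n j v, x⟫_ℝ :=
    h.mapL (innerSL ℝ (mode n j v))
  refine h1.unique ?_
  have h2 : (fun k => ⟪mode n j v, mode n k (c k)⟫_ℝ) = fun k => if k = j then ⟪v, c j⟫_ℝ else 0 := by
    funext k
    rw [← inner_coeff, coeff_mode]
    by_cases hk : k = j
    · subst hk; simp
    · simp [hk]
  rw [h2]
  exact hasSum_ite_eq j _

theorem coeff_add {n : ℕ} (x y : L2Loop n) (j : ℤ) :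
    coeff (x + y) j = coeff x j + coeff y j := by
  refine ext_inner_left ℝ fun v => ?_
  simp only [inner_add_right, inner_coeff]

theorem coeff_smul {n : ℕ} (r : ℝ) (x : L2Loop n) (j : ℤ) :
    coeff (r • x) j = r • coeff x j := by
  refine ext_inner_left ℝ fun v => ?_
  simp only [inner_smul_right, inner_coeff]

/-- The set `E^{1/2}_{τ₀}` of all `x = ∑_j e^{2πjtJ₀} x_j` in `L²(S¹; ℝ²ⁿ)` with `x_j ∈ L₀` and
`∑_j |j| |x_j|² < ∞`, as a linear subspace of `L²(S¹; ℝ²ⁿ)`. -/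
def loopSubmodule (n : ℕ) : Submodule ℝ (L2Loop n) where
  carrier := {x | ∃ c : ℤ → Phase n, (∀ j, c j ∈ L0 n) ∧
    Summable (fun j : ℤ => |(j : ℝ)| * ‖c j‖ ^ 2) ∧ HasSum (fun j => mode n j (c j)) x}
  zero_mem' := ⟨0, by simp, by simp, by simp⟩
  add_mem' := by
    rintro x y ⟨c, hc, hcs, hcx⟩ ⟨d, hd, hds, hdy⟩
    refine ⟨c + d, fun j => (L0 n).add_mem (hc j) (hd j), ?_, ?_⟩
    · refine Summable.of_nonneg_of_le (fun j => by positivity) (fun j => ?_)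
        ((hcs.mul_left 2).add (hds.mul_left 2))
      have h1 : ‖(c + d) j‖ ^ 2 ≤ 2 * ‖c j‖ ^ 2 + 2 * ‖d j‖ ^ 2 := by
        have := norm_add_le (c j) (d j)
        have h0 := norm_nonneg (c j + d j)
        simp only [Pi.add_apply]
        nlinarith [sq_nonneg (‖c j‖ - ‖d j‖)]
      nlinarith [mul_le_mul_of_nonneg_left h1 (abs_nonneg (j : ℝ))]
    · simpa using hcx.add hdy
  smul_mem' := by
    rintro r x ⟨c, hc, hcs, hcx⟩
    refine ⟨r • c, fun j => (L0 n).smul_mem r (hc j), ?_, ?_⟩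
    · refine (hcs.mul_left (r ^ 2)).congr fun j => ?_
      simp only [Pi.smul_apply, norm_smul, mul_pow, Real.norm_eq_abs, sq_abs]
      ring
    · simpa using hcx.const_smul r

/-- The space `𝔼 = E^{1/2}_{τ₀}`. It is a type of its own because it carries the norm
`‖·‖_{1/2}` and not the norm of `L²`. -/
def E (n : ℕ) : Type := loopSubmodule n

namespace E

variable {n : ℕ}

instance : AddCommGroup (E n) := inferInstanceAs (AddCommGroup (loopSubmodule n))

instance : Module ℝ (E n) := inferInstanceAs (Module ℝ (loopSubmodule n))

/-- The inclusion `𝔼 ⊆ L²(S¹; ℝ²ⁿ)`. -/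
def toL2 : E n →ₗ[ℝ] L2Loop n := (loopSubmodule n).subtype

theorem toL2_injective : Function.Injective (toL2 : E n → L2Loop n) := Subtype.val_injective

/-- The coefficient `x_j` in `x = ∑_j e^{2πjtJ₀} x_j`. -/
def coef (x : E n) (j : ℤ) : Phase n := coeff (toL2 x) j

theorem coef_add (x y : E n) (j : ℤ) : (x + y).coef j = x.coef j + y.coef j := by
  rw [coef, map_add, coeff_add]; rfl

theorem coef_smul (r : ℝ) (x : E n) (j : ℤ) : (r • x).coef j = r • x.coef j := by
  rw [coef, map_smul, coeff_smul]; rfl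

theorem coef_spec (x : E n) : (∀ j, x.coef j ∈ L0 n) ∧
    Summable (fun j : ℤ => |(j : ℝ)| * ‖x.coef j‖ ^ 2) ∧
    HasSum (fun j => mode n j (x.coef j)) (toL2 x) := by
  obtain ⟨c, h1, h2, h3⟩ := x.2
  have h : x.coef = c := coeff_eq_of_hasSum h3
  rw [h]
  exact ⟨h1, h2, h3⟩

theorem summable_inner (x y : E n) :
    Summable fun j : ℤ => |2 * Real.pi * (j : ℝ)| * ⟪x.coef j, y.coef j⟫_ℝ := by
  have h := ((x.coef_spec.2.1.add y.coef_spec.2.1).mul_left (2 * Real.pi))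
  refine Summable.of_norm_bounded h fun j => ?_
  have h1 := abs_real_inner_le_norm (x.coef j) (y.coef j)
  have h2 : |⟪x.coef j, y.coef j⟫_ℝ| ≤ ‖x.coef j‖ ^ 2 + ‖y.coef j‖ ^ 2 := by
    nlinarith [sq_nonneg (‖x.coef j‖ - ‖y.coef j‖), sq_nonneg ‖x.coef j‖, sq_nonneg ‖y.coef j‖]
  rw [Real.norm_eq_abs, abs_mul, abs_abs, abs_mul, abs_of_pos Real.two_pi_pos]
  have := mul_le_mul_of_nonneg_left h2
    (mul_nonneg Real.two_pi_pos.le (abs_nonneg (j : ℝ)))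
  linarith

/-- The inner product `⟨x, y⟩_{1/2} = ⟨x_0, y_0⟩ + ∑_j |2πj| ⟨x_j, y_j⟩`. -/
abbrev innerCore : InnerProductSpace.Core ℝ (E n) where
  inner x y := ⟪x.coef 0, y.coef 0⟫_ℝ +
    ∑' j : ℤ, |2 * Real.pi * (j : ℝ)| * ⟪x.coef j, y.coef j⟫_ℝ
  conj_inner_symm x y := by
    simp only [conj_trivial, real_inner_comm]
  re_inner_nonneg x := by
    simp only [RCLike.re_to_real]
    exact add_nonneg real_inner_self_nonneg
      (tsum_nonneg fun j => mul_nonneg (abs_nonneg _) real_inner_self_nonneg)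
  add_left x y z := by
    simp only [coef_add, inner_add_left, mul_add]
    rw [(summable_inner x z).tsum_add (summable_inner y z)]
    ring
  smul_left x y r := by
    simp only [coef_smul, real_inner_smul_left, conj_trivial]
    rw [mul_add, ← tsum_mul_left]
    congr 1
    exact tsum_congr fun j => by ring
  definite x hx := by
    have h0 : 0 ≤ ⟪x.coef 0, x.coef 0⟫_ℝ := real_inner_self_nonneg
    have hj : ∀ j : ℤ, 0 ≤ |2 * Real.pi * (j : ℝ)| * ⟪x.coef j, x.coef j⟫_ℝ :=
      fun j => mul_nonneg (abs_nonneg _) real_inner_self_nonneg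
    have hs : 0 ≤ ∑' j : ℤ, |2 * Real.pi * (j : ℝ)| * ⟪x.coef j, x.coef j⟫_ℝ := tsum_nonneg hj
    have hz : ∀ j : ℤ, x.coef j = 0 := by
      intro j
      by_cases hj0 : j = 0
      · subst hj0
        exact inner_self_eq_zero.1 (le_antisymm (by linarith) h0)
      · have ht := (summable_inner x x).le_tsum j (fun k _ => hj k)
        have h1 : |2 * Real.pi * (j : ℝ)| * ⟪x.coef j, x.coef j⟫_ℝ = 0 :=
          le_antisymm (by linarith) (hj j)
        rcases mul_eq_zero.1 h1 with h2 | h2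
        · exfalso
          have : (j : ℝ) ≠ 0 := by exact_mod_cast hj0
          simp [Real.pi_ne_zero, this] at h2
        · exact inner_self_eq_zero.1 h2
    have h3 := x.coef_spec.2.2
    simp only [hz, map_zero] at h3
    refine toL2_injective ?_
    rw [map_zero]
    exact h3.unique hasSum_zero

instance : NormedAddCommGroup (E n) := 
  @InnerProductSpace.Core.toNormedAddCommGroup ℝ (E n) _ _ _ innerCore

instance : InnerProductSpace ℝ (E n) := InnerProductSpace.ofCore innerCore.toCore

/-- For `x = ∑_j e^{2πjtJ₀} x_j`, the partial series over the `j` in `A`. -/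
def part (A : Set ℤ) (x : E n) : E n :=
  ⟨∑' j : ℤ, mode n j (A.indicator x.coef j), A.indicator x.coef, by
    intro j
    by_cases hj : j ∈ A
    · simpa [hj] using x.coef_spec.1 j
    · simp [hj], by
    refine Summable.of_nonneg_of_le (fun j => by positivity) (fun j => ?_) x.coef_spec.2.1
    by_cases hj : j ∈ A
    · simp [hj]
    · rw [indicator_of_notMem hj, norm_zero, zero_pow two_ne_zero, mul_zero]
      positivity, by
    refine Summable.hasSum ?_
    refine (x.coef_spec.2.2.summable.indicator A).congr fun j => ?_
    by_cases hj : j ∈ A <;> simp [hj]⟩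

/-- The component `x⁺` of `x` in `𝔼⁺`. -/
def plus (x : E n) : E n := x.part {j | 0 < j}

/-- The component `x⁰` of `x` in `𝔼⁰`. -/
def zero (x : E n) : E n := x.part {0}

/-- The component `x⁻` of `x` in `𝔼⁻`. -/
def minus (x : E n) : E n := x.part {j | j < 0}

/-- The elements `x` of `𝔼` with `x_j = 0` for all `j` outside of `A`. -/
def supportedOn (n : ℕ) (A : Set ℤ) : Submodule ℝ (E n) where
  carrier := {x | ∀ j, j ∉ A → x.coef j = 0}
  zero_mem' j _ := by simpa using coef_smul (0 : ℝ) (0 : E n) j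
  add_mem' hx hy j hj := by rw [coef_add, hx j hj, hy j hj, add_zero]
  smul_mem' r x hx j hj := by rw [coef_smul, hx j hj, smul_zero]

end E

/-- `𝔼⁺`. -/
def Eplus (n : ℕ) : Submodule ℝ (E n) := E.supportedOn n {j | 0 < j}

/-- `𝔼⁰`, the constant loops with value in `L₀`. -/
def Ezero (n : ℕ) : Submodule ℝ (E n) := E.supportedOn n {0}

/-- `𝔼⁻`. -/
def Eminus (n : ℕ) : Submodule ℝ (E n) := E.supportedOn n {j | j < 0}

/-- The unit sphere `S⁺` of `𝔼⁺`. -/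
def Splus (n : ℕ) : Set (E n) := {x | x ∈ Eplus n ∧ ‖x‖ = 1}

/-- The action functional `Φ_H(x) = ½ (‖x⁺‖² - ‖x⁻‖²) - ∫₀¹ H(x(t)) dt` on `𝔼`. -/
def action {n : ℕ} (H : Phase n → ℝ) (x : E n) : ℝ :=
  (1 / 2) * (‖x.plus‖ ^ 2 - ‖x.minus‖ ^ 2) - ∫ t : UnitAddCircle, H (x.toL2 t)

/-- `γ` is an admissible deformation of `𝔼`: there is a homotopy `G u`, `0 ≤ u ≤ 1`, from the
identity to `γ` such that every `G u` maps `𝔼 \ (𝔼⁻ ⊕ 𝔼⁰)` onto itself, and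
`G u x = a(x,u) x⁺ + b(x,u) x⁰ + c(x,u) x⁻ + K(x,u)` for a continuous map
`(a, b, c, K) : 𝔼 × [0,1] → (0,∞)³ × 𝔼` that maps bounded sets to relatively compact sets
(relatively compact in `(0,∞)³ × 𝔼`, so that `a`, `b`, `c` stay away from `0` and `∞`
on bounded sets). -/
def IsAdmissible {n : ℕ} (γ : E n → E n) : Prop :=
  Continuous γ ∧ ∃ G : unitInterval → E n → E n,
    (Continuous fun p : E n × unitInterval => G p.2 p.1) ∧
    G 0 = id ∧ G 1 = γ ∧
    (∀ u, G u '' ((Eminus n ⊔ Ezero n : Submodule ℝ (E n)) : Set (E n))ᶜ =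
      ((Eminus n ⊔ Ezero n : Submodule ℝ (E n)) : Set (E n))ᶜ) ∧
    ∃ (a b c : E n × unitInterval → Ioi (0 : ℝ)) (K : E n × unitInterval → E n),
      Continuous (fun p => (a p, b p, c p, K p)) ∧
      (∀ B : Set (E n × unitInterval), Bornology.IsBounded B →
        IsCompact (closure ((fun p => (a p, b p, c p, K p)) '' B))) ∧
      ∀ x u, G u x = (a (x, u) : ℝ) • x.plus + (b (x, u) : ℝ) • x.zero
        + (c (x, u) : ℝ) • x.minus + K (x, u)

/-- `c_{EH,τ₀}(H) = sup_{γ ∈ Γ} inf_{x ∈ γ(S⁺)} Φ_H(x)`, with `Γ` the set of all admissible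
deformations; supremum and infimum are taken in `[-∞, ∞]`. -/
def cEH {n : ℕ} (H : Phase n → ℝ) : EReal :=
  ⨆ γ ∈ {γ : E n → E n | IsAdmissible γ}, ⨅ x ∈ γ '' Splus n, (action H x : EReal)

/-- `H(z) = a|z|² + ⟨z, z₀⟩ + b` outside of a compact set. -/
def EqQuadraticOutsideCompact {n : ℕ} (H : Phase n → ℝ) (z₀ : Phase n) (a b : ℝ) : Prop :=
  ∃ C : Set (Phase n), IsCompact C ∧ ∀ z ∉ C, H z = a * ‖z‖ ^ 2 + ⟪z, z₀⟫_ℝ + b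

/-- `H` is quadratic at infinity: outside of a compact set `H(z) = a|z|² + ⟨z, z₀⟩ + b` with
`z₀ ∈ L₀`, `a > 2π` and `b ∈ ℝ`. -/
def QuadraticAtInfinity {n : ℕ} (H : Phase n → ℝ) : Prop :=
  ∃ z₀ ∈ L0 n, ∃ a b : ℝ, 2 * Real.pi < a ∧ EqQuadraticOutsideCompact H z₀ a b

/-- `H` is nonresonant: it is quadratic at infinity with an `a` that is not an integer
multiple of `π`. -/
def Nonresonant {n : ℕ} (H : Phase n → ℝ) : Prop :=
  ∃ z₀ ∈ L0 n, ∃ a b : ℝ, 2 * Real.pi < a ∧ (∀ k : ℤ, a ≠ k * Real.pi) ∧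
    EqQuadraticOutsideCompact H z₀ a b

/-- `c` is a critical value of `Φ_H`: there is `x ∈ 𝔼` at which `Φ_H` is (Fréchet)
differentiable with derivative zero and `Φ_H(x) = c`. -/
def IsCriticalValue {n : ℕ} (H : Phase n → ℝ) (c : ℝ) : Prop :=
  ∃ x : E n, HasFDerivAt (action H) (0 : E n →L[ℝ] ℝ) x ∧ action H x = c

end SymEH

end

/-!
Let `ι : 𝔼 → L²` be the inclusion; its adjoint `ι*` is compact. The action `Φ_H` has the Lipschitz
gradient `x⁺ - x⁻ - ι* (∇H ∘ x)`, a compact perturbation of `x ↦ x⁺ - x⁻`.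

*Finiteness.* By Brouwer's theorem on Galerkin truncations, `γ(S⁺)` meets `𝔼⁻ ⊕ 𝔼⁰ ⊕ ℝe` for every
admissible `γ`, where `e` is a vector of mode `1`. There `Φ_H` is bounded above, since `a > π`.
Translating a small sphere of `𝔼⁺` to a point of `L₀` near which `H` vanishes shows `c > 0`.

*Criticality.* Since `a ∉ πℤ`, the gradient of the quadratic part at infinity is bounded below by a
multiple of `‖x‖`, and the Palais–Smale condition holds. If `c` were not critical, an explicit Euler
step of the gradient flow, cut off by `‖x⁺‖ / (1 + ‖x‖)`, would raise the level `c`. The cutoff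
makes the step admissible, and because `H ≥ 0` it stays away from `0` where `Φ_H ≥ c / 2`.
-/

namespace SymEH

section Brouwer

open Metric Filter Topology
open scoped NNReal

theorem bijective_add_of_lipschitzWith {X : Type*} [NormedAddCommGroup X] [CompleteSpace X]
    {g : X → X} {c : ℝ≥0} (hc : c < 1) (hg : LipschitzWith c g) :
    Function.Bijective fun x => x + g x := by
  constructor
  · intro x y hxy
    have hsub : x - y = g y - g x := by
      have : x + g x = y + g y := hxy
      rw [sub_eq_sub_iff_add_eq_add, this, add_comm]
    have hle : ‖x - y‖ ≤ c * ‖x - y‖ := by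
      simpa only [dist_eq_norm, ← hsub, norm_sub_rev y x] using hg.dist_le_mul y x
    have hzero : ‖x - y‖ = 0 := by nlinarith [norm_nonneg (x - y), NNReal.coe_lt_one.2 hc]
    exact sub_eq_zero.1 (norm_eq_zero.1 hzero)
  · intro y
    have hK : ContractingWith c fun x => y - g x :=
      ⟨hc, LipschitzWith.of_dist_le_mul fun a b => by
        rw [dist_sub_left]; exact hg.dist_le_mul a b⟩
    exact ⟨hK.fixedPoint, (sub_eq_iff_eq_add.1 hK.fixedPoint_isFixedPt).symm⟩

theorem image_add_eq_of_lipschitzWith {X : Type*} [NormedAddCommGroup X] [CompleteSpace X]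
    {g : X → X} {c : ℝ≥0} (hc : c < 1) (hg : LipschitzWith c g) {U : Set X}
    (hU : ∀ x ∉ U, g x = 0) : (fun x => x + g x) '' U = U := by
  have hbij := bijective_add_of_lipschitzWith hc hg
  have hcompl : (fun x => x + g x) '' Uᶜ = Uᶜ := by
    rw [image_congr fun x hx => show x + g x = id x by rw [hU x hx, add_zero, id], image_id]
  rw [← compl_inj_iff, ← image_compl_eq hbij, hcompl]

theorem exists_mem_segment_mem_frontier {X : Type*} [AddCommGroup X] [Module ℝ X]
    [TopologicalSpace X] [ContinuousAdd X] [ContinuousSMul ℝ X] {s : Set X} {x y : X}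
    (hx : x ∈ s) (hy : y ∉ s) : ∃ z ∈ segment ℝ x y, z ∈ frontier s := by
  by_contra! h
  have hcover : segment ℝ x y ⊆ interior s ∪ (closure s)ᶜ := fun z hz => by
    by_contra hz'
    rw [mem_union, not_or, notMem_compl_iff] at hz'
    exact h z hz ⟨hz'.2, hz'.1⟩
  have hxs : x ∈ interior s := (hcover (left_mem_segment ℝ x y)).resolve_right
    (notMem_compl_iff.2 (subset_closure hx))
  have hsub := (convex_segment x y).isPreconnected.subset_left_of_subset_union isOpen_interior
    isClosed_closure.isOpen_compl
    (disjoint_compl_right_iff_subset.2 interior_subset_closure) hcover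
    ⟨x, left_mem_segment ℝ x y, hxs⟩
  exact hy (interior_subset (hsub (right_mem_segment ℝ x y)))

theorem lipschitzWith_indicator_of_frontier_eq_zero {X Y : Type*} [NormedAddCommGroup X]
    [NormedSpace ℝ X] [NormedAddCommGroup Y] {f : X → Y} {K : ℝ≥0} {s : Set X}
    (hs : IsClosed s) (hf : LipschitzOnWith K f s) (h0 : ∀ x ∈ frontier s, f x = 0) :
    LipschitzWith K (s.indicator f) := by
  have hmix : ∀ x ∈ s, ∀ y ∉ s, dist (s.indicator f x) (s.indicator f y) ≤ K * dist x y := by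
    intro x hx y hy
    obtain ⟨z, hz, hzs⟩ := exists_mem_segment_mem_frontier hx hy
    rw [indicator_of_mem hx, indicator_of_notMem hy, ← h0 z hzs]
    refine (hf.dist_le_mul x hx z (hs.frontier_subset hzs)).trans ?_
    have := dist_add_dist_of_mem_segment hz
    gcongr
    linarith [dist_nonneg (x := z) (y := y)]
  refine LipschitzWith.of_dist_le_mul fun x y => ?_
  by_cases hx : x ∈ s <;> by_cases hy : y ∈ s
  · simpa only [indicator_of_mem hx, indicator_of_mem hy] using hf.dist_le_mul x hx y hy
  · exact hmix x hx y hy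
  · simpa only [dist_comm] using hmix y hy x hx
  · rw [indicator_of_notMem hx, indicator_of_notMem hy, dist_self]
    positivity

open Polynomial in
theorem det_one_add_eq_sum_lagrange {V : Type*} [AddCommGroup V] [Module ℝ V]
    [FiniteDimensional ℝ V] (A : V →ₗ[ℝ] V) (s : Finset ℝ)
    (hs : Module.finrank ℝ V < s.card) :
    LinearMap.det (1 + A) =
      ∑ t ∈ s, (Lagrange.basis s id t).eval 1 * LinearMap.det (1 + t • A) := by
  classical
  let b := Module.finBasis ℝ V
  let M := LinearMap.toMatrix b b A
  let p : ℝ[X] := Matrix.det ((X : ℝ[X]) • M.map C + (1 : Matrix _ _ ℝ).map C)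
  have hp : ∀ t : ℝ, p.eval t = LinearMap.det (1 + t • A) := by
    intro t
    rw [← LinearMap.det_toMatrix b, ← coe_evalRingHom, RingHom.map_det]
    congr 1
    ext i j
    by_cases hij : i = j
    · simp [M, LinearMap.toMatrix_one, hij, add_comm, mul_comm t]
    · simp [M, LinearMap.toMatrix_one, hij, mul_comm t]
  have hdeg : p.degree < s.card := by
    refine degree_le_natDegree.trans_lt ?_
    have h := natDegree_det_X_add_C_le M 1
    rw [Fintype.card_fin] at h
    exact_mod_cast h.trans_lt hs
  have hinterp := congrArg (Polynomial.eval 1)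
    (Lagrange.eq_interpolate (s := s) (v := id) Function.injective_id.injOn hdeg)
  rw [Lagrange.interpolate_apply, eval_finsetSum, hp, one_smul] at hinterp
  rw [hinterp]
  refine Finset.sum_congr rfl fun t _ => ?_
  rw [eval_mul, eval_C, id, hp, mul_comm]

variable {V : Type*} [NormedAddCommGroup V] [NormedSpace ℝ V] [FiniteDimensional ℝ V]

theorem det_one_add_pos {A : V →L[ℝ] V} (hA : ‖A‖ < 1) : 0 < (1 + A).det := by
  have hne : ∀ s ∈ Icc (0 : ℝ) 1, (1 + s • A).det ≠ 0 := by
    intro s hs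
    have hlt : ‖-(s • A)‖ < 1 := by
      rw [norm_neg, norm_smul, Real.norm_of_nonneg hs.1]
      exact (mul_le_of_le_one_left (norm_nonneg A) hs.2).trans_lt hA
    have hu := (isUnit_one_sub_of_norm_lt_one hlt).map ContinuousLinearMap.toLinearMapRingHom
    rw [sub_neg_eq_add] at hu
    exact (hu.map LinearMap.det).ne_zero
  have hc : ContinuousOn (fun s : ℝ => (1 + s • A).det) (Icc 0 1) :=
    (ContinuousLinearMap.continuous_det.comp (by fun_prop)).continuousOn
  by_contra hneg
  have hmem : (0 : ℝ) ∈ Icc ((1 + (1 : ℝ) • A).det) ((1 + (0 : ℝ) • A).det) := by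
    simpa [ContinuousLinearMap.det] using hneg
  obtain ⟨s, hs, hs0⟩ := intermediate_value_Icc' zero_le_one hc hmem
  exact hne s hs hs0

theorem det_fderiv_eq_zero_of_norm_eq {W : Type*} [NormedAddCommGroup W]
    [InnerProductSpace ℝ W] [FiniteDimensional ℝ W] {r : W → W} {R : ℝ} {x : W}
    (hr : DifferentiableAt ℝ r x) (hR : R ≠ 0) (hnorm : ∀ y, ‖r y‖ = R) :
    (fderiv ℝ r x).det = 0 := by
  by_contra hdet
  obtain ⟨v, hv⟩ := (LinearMap.equivOfDetNeZero _ hdet).surjective (r x)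
  replace hv : fderiv ℝ r x v = r x := hv
  have hsq := hr.hasFDerivAt.norm_sq
  simp only [hnorm] at hsq
  have hder := congrArg (fun T : W →L[ℝ] ℝ => T v) (hsq.unique (hasFDerivAt_const (R ^ 2) x))
  simp [hv, hnorm, hR] at hder

variable [MeasurableSpace V] [BorelSpace V] (μ : Measure V) [μ.IsAddHaarMeasure]
  {g : V → V} {L : ℝ≥0} {U : Set V}

theorem setLIntegral_det_one_add_fderiv (hg : LipschitzWith L g) (hL : L < 1) (hU : IsOpen U)
    (h0 : ∀ x ∉ U, g x = 0) (hd : DifferentiableOn ℝ g U) :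
    ∫⁻ x in U, ENNReal.ofReal (1 + fderiv ℝ g x).det ∂μ = μ U := by
  have hder : ∀ x ∈ U, HasFDerivWithinAt (fun x => x + g x) (1 + fderiv ℝ g x) U x := fun x hx =>
    ((hasFDerivAt_id x).add (hd.hasFDerivAt (hU.mem_nhds hx))).hasFDerivWithinAt
  have hcov := lintegral_abs_det_fderiv_eq_addHaar_image μ hU.measurableSet hder
    (bijective_add_of_lipschitzWith hL hg).1.injOn
  rw [image_add_eq_of_lipschitzWith hL hg h0] at hcov
  rw [← hcov]
  refine lintegral_congr fun x => ?_
  have hnorm : ‖fderiv ℝ g x‖ < 1 :=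
    (norm_fderiv_le_of_lipschitz ℝ hg).trans_lt (by exact_mod_cast hL)
  rw [abs_of_pos (det_one_add_pos hnorm)]

theorem integrableOn_det_one_add_smul_fderiv_and_integral_eq (hg : LipschitzWith L g)
    (hU : IsOpen U) (hμU : μ U ≠ ⊤) (h0 : ∀ x ∉ U, g x = 0) (hd : ContDiffOn ℝ 1 g U)
    {t : ℝ} (ht : 0 ≤ t) (htL : t * L < 1) :
    IntegrableOn (fun x => (1 + t • fderiv ℝ g x).det) U μ ∧
      ∫ x in U, (1 + t • fderiv ℝ g x).det ∂μ = μ.real U := by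
  have hLip : LipschitzWith (t.toNNReal * L) (t • g) :=
    LipschitzWith.of_dist_le_mul fun x y => by
      simp only [Pi.smul_apply, dist_smul₀, Real.norm_of_nonneg ht, NNReal.coe_mul,
        Real.coe_toNNReal _ ht, mul_assoc]
      exact mul_le_mul_of_nonneg_left (hg.dist_le_mul x y) ht
  have htL' : t.toNNReal * L < 1 := by
    rwa [← NNReal.coe_lt_coe, NNReal.coe_mul, Real.coe_toNNReal _ ht]
  have hfd : ∀ x ∈ U, fderiv ℝ (t • g) x = t • fderiv ℝ g x := fun x hx =>
    fderiv_const_smul ((hd.differentiableOn one_ne_zero).differentiableAt (hU.mem_nhds hx)) t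
  have hlint : ∫⁻ x in U, ENNReal.ofReal (1 + t • fderiv ℝ g x).det ∂μ = μ U := by
    rw [← setLIntegral_det_one_add_fderiv μ hLip htL' hU
      (fun x hx => by rw [Pi.smul_apply, h0 x hx, smul_zero])
      ((hd.differentiableOn one_ne_zero).const_smul t)]
    exact setLIntegral_congr_fun hU.measurableSet fun x hx => by simp only [hfd x hx]
  have hpos : ∀ x, 0 ≤ (1 + t • fderiv ℝ g x).det := fun x => by
    refine (det_one_add_pos ?_).le
    rw [norm_smul, Real.norm_of_nonneg ht]
    exact (mul_le_mul_of_nonneg_left (norm_fderiv_le_of_lipschitz ℝ hg) ht).trans_lt htL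
  have hmeas : AEStronglyMeasurable (fun x => (1 + t • fderiv ℝ g x).det) (μ.restrict U) :=
    (ContinuousLinearMap.continuous_det.comp_continuousOn (continuousOn_const.add
      ((hd.continuousOn_fderiv_of_isOpen hU le_rfl).const_smul t))).aestronglyMeasurable
      hU.measurableSet
  constructor
  · rwa [IntegrableOn, ← lintegral_ofReal_ne_top_iff_integrable hmeas (ae_of_all _ hpos), hlint]
  · rw [integral_eq_lintegral_of_nonneg_ae (ae_of_all _ hpos) hmeas, hlint, Measure.real]

-- The integral is polynomial in the factor `t` of `t • g` and constant for small `t ≥ 0`.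
theorem integral_det_one_add_fderiv (hg : LipschitzWith L g) (hU : IsOpen U) (hμU : μ U ≠ ⊤)
    (h0 : ∀ x ∉ U, g x = 0) (hd : ContDiffOn ℝ 1 g U) :
    ∫ x in U, (1 + fderiv ℝ g x).det ∂μ = μ.real U := by
  obtain ⟨s, hs0, hs⟩ : ∃ s : Finset ℝ, (∀ t ∈ s, 0 ≤ t ∧ t * L < 1) ∧
      Module.finrank ℝ V < s.card := by
    have hinf : (Icc (0 : ℝ) (1 / (L + 1))).Infinite := Icc_infinite (by positivity)
    obtain ⟨s, hs, hcard⟩ := hinf.exists_subset_card_eq (Module.finrank ℝ V + 1)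
    refine ⟨s, fun t ht => ⟨(hs ht).1, ?_⟩, by omega⟩
    calc t * L ≤ 1 / (L + 1) * L := mul_le_mul_of_nonneg_right (hs ht).2 L.2
      _ < 1 := by rw [one_div, inv_mul_lt_iff₀ (by positivity)]; linarith
  have hint := fun t ht =>
    integrableOn_det_one_add_smul_fderiv_and_integral_eq μ hg hU hμU h0 hd (hs0 t ht).1 (hs0 t ht).2
  have hsum : ∑ t ∈ s, (Lagrange.basis s id t).eval 1 = (1 : ℝ) := by
    rw [← Polynomial.eval_finsetSum, Lagrange.sum_basis Function.injective_id.injOn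
      (Finset.card_pos.1 (by omega)), Polynomial.eval_one]
  calc ∫ x in U, (1 + fderiv ℝ g x).det ∂μ
      = ∫ x in U, ∑ t ∈ s, (Lagrange.basis s id t).eval 1 * (1 + t • fderiv ℝ g x).det ∂μ :=
        integral_congr_ae (ae_of_all _ fun x => det_one_add_eq_sum_lagrange _ s hs)
    _ = ∑ t ∈ s, (Lagrange.basis s id t).eval 1 * μ.real U := by
        rw [integral_finsetSum _ fun t ht => (hint t ht).1.const_mul _]
        exact Finset.sum_congr rfl fun t ht => by rw [integral_const_mul, (hint t ht).2]
    _ = μ.real U := by rw [← Finset.sum_mul, hsum, one_mul]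

variable {W : Type*} [NormedAddCommGroup W] [InnerProductSpace ℝ W] [FiniteDimensional ℝ W]

theorem not_eqOn_sphere_of_contDiff_of_norm_eq {r : W → W} (hr : ContDiff ℝ 1 r) {R : ℝ}
    (hR : 0 < R) (hnorm : ∀ x, ‖r x‖ = R) : ¬ EqOn r id (sphere 0 R) := by
  intro hid
  borelize W
  let g : W → W := (closedBall (0 : W) R).indicator (r - id)
  have heq : EqOn g (r - id) (ball 0 R) := fun x hx =>
    indicator_of_mem (ball_subset_closedBall hx) _
  have hsub : ContDiff ℝ 1 (r - id) := hr.sub contDiff_id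
  have hsphere : ∀ x ∈ sphere (0 : W) R, (r - id : W → W) x = 0 := fun x hx =>
    sub_eq_zero.2 (hid hx)
  obtain ⟨L, hL⟩ := (hsub.locallyLipschitz.locallyLipschitzOn (s := closedBall 0 R)
    ).exists_lipschitzOnWith_of_compact (isCompact_closedBall _ _)
  have hg : LipschitzWith L g := lipschitzWith_indicator_of_frontier_eq_zero isClosed_closedBall hL
    (by rwa [frontier_closedBall _ hR.ne'])
  have hout : ∀ x ∉ ball (0 : W) R, g x = 0 := fun x hx => by
    by_cases hx' : x ∈ closedBall (0 : W) R
    · exact (indicator_of_mem hx' _).trans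
        (hsphere x (closedBall_sdiff_ball (x := (0 : W)) ▸ ⟨hx', hx⟩))
    · exact indicator_of_notMem hx' _
  have hint := integral_det_one_add_fderiv (volume : Measure W) hg isOpen_ball
    measure_ball_lt_top.ne hout (hsub.contDiffOn.congr heq)
  have hdet : ∀ x ∈ ball (0 : W) R, (1 + fderiv ℝ g x).det = 0 := fun x hx => by
    have hrx := hr.differentiable one_ne_zero x
    have hfd : fderiv ℝ g x = fderiv ℝ r x - 1 := by
      rw [(heq.eventuallyEq_of_mem (isOpen_ball.mem_nhds hx)).fderiv_eq,
        fderiv_sub hrx differentiableAt_id, fderiv_id]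
      rfl
    rw [hfd, add_sub_cancel, det_fderiv_eq_zero_of_norm_eq hrx hR.ne' hnorm]
  rw [setIntegral_congr_fun measurableSet_ball hdet, integral_zero] at hint
  exact (ENNReal.toReal_pos (measure_ball_pos _ _ hR).ne' measure_ball_lt_top.ne).ne hint

theorem exists_eq_zero_of_eq_id_of_one_le_norm {φ : W → W} (hφ : Continuous φ)
    (hid : ∀ x, 1 ≤ ‖x‖ → φ x = x) : ∃ x, φ x = 0 := by
  by_contra! hne
  obtain ⟨F, hF, hFd, hFS, -⟩ := hφ.exists_contDiff_approx_and_eqOn ⊤ hφ.norm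
    (fun x => norm_pos_iff.2 (hne x)) (S := {x | 3 / 2 ≤ ‖x‖}) (U := {x | 1 < ‖x‖})
    (isClosed_le continuous_const continuous_norm)
    ((isOpen_lt continuous_const continuous_norm).mem_nhdsSet.2 fun x (hx : 3 / 2 ≤ ‖x‖) =>
      show 1 < ‖x‖ by linarith)
    (contDiff_id.contDiffOn.congr fun x hx => hid x (le_of_lt hx))
  have hF0 : ∀ x, F x ≠ 0 := fun x h0 => by
    simpa only [h0, dist_zero_left, lt_irrefl] using hFd x
  let r : W → W := fun x => (2 / ‖F x‖) • F x
  have hr : ContDiff ℝ 1 r :=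
    ((contDiff_const.div (hF.norm ℝ hF0) fun x => norm_ne_zero_iff.2 (hF0 x)).smul hF).of_le
      (by exact_mod_cast le_top)
  refine not_eqOn_sphere_of_contDiff_of_norm_eq hr two_pos (fun x => ?_) fun x hx => ?_
  · simp only [r, norm_smul, norm_div, norm_norm, Real.norm_ofNat]
    exact div_mul_cancel₀ _ (norm_ne_zero_iff.2 (hF0 x))
  · rw [mem_sphere_zero_iff_norm] at hx
    have hFx : F x = x := by
      rw [hFS (show 3 / 2 ≤ ‖x‖ by rw [hx]; norm_num), hid x (by rw [hx]; norm_num)]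
    simp only [r, hFx, hx, div_self (two_ne_zero (α := ℝ)), one_smul, id]

theorem norm_inv_norm_smul {X : Type*} [NormedAddCommGroup X] [NormedSpace ℝ X] {x : X}
    (hx : x ≠ 0) : ‖‖x‖⁻¹ • x‖ = 1 := by
  rw [norm_smul, norm_inv, norm_norm, inv_mul_cancel₀ (norm_ne_zero_iff.2 hx)]

theorem continuous_norm_smul_comp_inv_norm_smul {X Y : Type*} [NormedAddCommGroup X]
    [NormedSpace ℝ X] [ProperSpace X] [NormedAddCommGroup Y] [NormedSpace ℝ Y] {f : X × ℝ → Y}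
    (hf : Continuous f) {c : X → ℝ} (hc : Continuous c) (hc01 : ∀ x, c x ∈ Icc (0 : ℝ) 1) :
    Continuous fun x => ‖x‖ • f (‖x‖⁻¹ • x, c x) := by
  rw [continuous_iff_continuousAt]
  intro x
  rcases eq_or_ne x 0 with rfl | hx
  · obtain ⟨C, hC⟩ := ((isCompact_closedBall (0 : X) 1).prod
      (isCompact_Icc (a := (0 : ℝ)) (b := 1))).exists_bound_of_continuousOn hf.continuousOn
    have hbd : ∀ x : X, ‖f (‖x‖⁻¹ • x, c x)‖ ≤ C := fun x => by
      refine hC _ ⟨mem_closedBall_zero_iff.2 ?_, hc01 x⟩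
      rcases eq_or_ne x 0 with rfl | hx
      · simp
      · exact (norm_inv_norm_smul hx).le
    rw [ContinuousAt, norm_zero, zero_smul]
    exact NormedField.tendsto_zero_smul_of_tendsto_zero_of_bounded tendsto_norm_zero
      (isBoundedUnder_of ⟨C, hbd⟩)
  · have hinv := continuous_norm.continuousAt.inv₀ (norm_ne_zero_iff.2 hx)
    exact continuous_norm.continuousAt.smul (ContinuousAt.comp (f := fun x => (‖x‖⁻¹ • x, c x))
      hf.continuousAt ((hinv.smul continuousAt_id).prodMk hc.continuousAt))

theorem exists_mem_ray_of_homotopy {f : W × ℝ → W} (hf : Continuous f)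
    (hf0 : ∀ x, ‖x‖ = 1 → f (x, 0) = x)
    (hfne : ∀ x, ‖x‖ = 1 → ∀ u ∈ Icc (0 : ℝ) 1, f (x, u) ≠ 0) {e : W} (he : e ≠ 0) :
    ∃ x, ‖x‖ = 1 ∧ ∃ s : ℝ, 0 ≤ s ∧ f (x, 1) = s • e := by
  -- The cone over the homotopy, pushed along `-e` near the origin, would have no zero.
  by_contra! hray
  let c : W → ℝ := fun x => max 0 (min 1 (2 - 2 * ‖x‖))
  have hcI : ∀ x, c x ∈ Icc (0 : ℝ) 1 := fun x =>
    ⟨le_max_left _ _, max_le zero_le_one (min_le_left _ _)⟩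
  let φ : W → W := fun x => ‖x‖ • f (‖x‖⁻¹ • x, c x) - max (1 - 2 * ‖x‖) 0 • e
  have hφ : Continuous φ :=
    (continuous_norm_smul_comp_inv_norm_smul hf (by fun_prop) hcI).sub (by fun_prop)
  obtain ⟨x, hx⟩ := exists_eq_zero_of_eq_id_of_one_le_norm hφ fun x hx => by
    have hx0 : x ≠ 0 := norm_pos_iff.1 (by linarith)
    have hcx : c x = 0 := max_eq_left ((min_le_right _ _).trans (by linarith))
    have hpush : max (1 - 2 * ‖x‖) 0 = 0 := max_eq_right (by linarith)
    simp only [φ, hcx, hpush, hf0 _ (norm_inv_norm_smul hx0), zero_smul, sub_zero]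
    rw [smul_inv_smul₀ (norm_ne_zero_iff.2 hx0)]
  have hx0 : x ≠ 0 := by
    rintro rfl
    exact he (by simpa [φ] using hx)
  have hn : 0 < ‖x‖ := norm_pos_iff.2 hx0
  rw [sub_eq_zero] at hx
  rcases le_or_gt (1 / 2) ‖x‖ with h | h
  · rw [max_eq_right (by linarith), zero_smul, smul_eq_zero] at hx
    exact hx.elim hn.ne' (hfne _ (norm_inv_norm_smul hx0) _ (hcI _))
  · have hcx : c x = 1 := by
      simp only [c]
      rw [min_eq_left (by linarith), max_eq_right zero_le_one]
    rw [hcx] at hx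
    refine hray _ (norm_inv_norm_smul hx0) (‖x‖⁻¹ * max (1 - 2 * ‖x‖) 0) (by positivity) ?_
    rw [mul_smul, ← hx, inv_smul_smul₀ hn.ne']

end Brouwer

section Modes

open Filter Topology

variable {n : ℕ}

theorem inner_mode (j k : ℤ) (v w : Phase n) :
    ⟪mode n j v, mode n k w⟫_ℝ = if k = j then ⟪v, w⟫_ℝ else 0 := by
  rw [← inner_coeff, coeff_mode]
  split_ifs <;> simp

theorem norm_mode (j : ℤ) (v : Phase n) : ‖mode n j v‖ = ‖v‖ := by
  have h := inner_mode j j v v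
  rwa [if_pos rfl, real_inner_self_eq_norm_sq, real_inner_self_eq_norm_sq,
    sq_eq_sq₀ (norm_nonneg _) (norm_nonneg _)] at h

theorem norm_rot (j : ℤ) (t : UnitAddCircle) (v : Phase n) : ‖rot n j t v‖ = ‖v‖ := by
  have h := inner_rot j t v (rot n j t v)
  rwa [rot_rot, neg_add_cancel, rot, fourier_zero, Complex.one_re, Complex.one_im, one_smul,
    zero_smul, add_zero, real_inner_self_eq_norm_sq, real_inner_self_eq_norm_sq, eq_comm,
    sq_eq_sq₀ (norm_nonneg _) (norm_nonneg _)] at h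

/-- The map `v ↦ e^{2πjtJ₀} v` as a linear isometry into `L²`. -/
noncomputable def modeIsometry (n : ℕ) (j : ℤ) : Phase n →ₗᵢ[ℝ] L2Loop n where
  toLinearMap := mode n j
  norm_map' := norm_mode j

theorem orthogonalFamily_modeIsometry (n : ℕ) :
    OrthogonalFamily ℝ (fun _ : ℤ => Phase n) (modeIsometry n) :=
  fun j k hjk v w => (inner_mode j k v w).trans (if_neg hjk.symm)

/-- The weight of the `j`-th mode in `⟨·, ·⟩_{1/2}`. -/
noncomputable def weight (j : ℤ) : ℝ := if j = 0 then 1 else 2 * Real.pi * |(j : ℝ)|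

theorem weight_of_ne {j : ℤ} (hj : j ≠ 0) : weight j = 2 * Real.pi * |(j : ℝ)| := if_neg hj

theorem abs_le_weight (j : ℤ) : |(j : ℝ)| ≤ weight j := by
  by_cases hj : j = 0
  · simp [hj, weight]
  · rw [weight_of_ne hj]
    nlinarith [Real.pi_gt_three, abs_nonneg (j : ℝ)]

theorem one_le_weight (j : ℤ) : 1 ≤ weight j := by
  by_cases hj : j = 0
  · simp [hj, weight]
  · refine le_trans ?_ (abs_le_weight j)
    rw [← Int.cast_abs]
    exact_mod_cast Int.one_le_abs hj

theorem weight_pos (j : ℤ) : 0 < weight j := zero_lt_one.trans_le (one_le_weight j)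

namespace E

theorem ext_coef {x y : E n} (h : ∀ j, x.coef j = y.coef j) : x = y := by
  refine toL2_injective (x.coef_spec.2.2.unique ?_)
  simpa only [h] using y.coef_spec.2.2

theorem coef_zero (j : ℤ) : (0 : E n).coef j = 0 := by
  simpa using coef_smul (0 : ℝ) (0 : E n) j

theorem coef_sub (x y : E n) (j : ℤ) : (x - y).coef j = x.coef j - y.coef j := by
  rw [eq_sub_iff_add_eq, ← coef_add, sub_add_cancel]

theorem hasSum_inner (x y : E n) :
    HasSum (fun j => weight j * ⟪x.coef j, y.coef j⟫_ℝ) ⟪x, y⟫_ℝ := by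
  refine ((hasSum_ite_eq (0 : ℤ) ⟪x.coef 0, y.coef 0⟫_ℝ).add
    (summable_inner x y).hasSum).congr_fun fun j => ?_
  by_cases hj : j = 0
  · subst hj
    simp [weight]
  · simp [weight_of_ne, hj, abs_mul, abs_of_pos Real.pi_pos]

theorem hasSum_norm_sq (x : E n) : HasSum (fun j => weight j * ‖x.coef j‖ ^ 2) (‖x‖ ^ 2) := by
  simpa only [real_inner_self_eq_norm_sq] using hasSum_inner x x

theorem hasSum_inner_toL2 (x y : E n) :
    HasSum (fun j => ⟪x.coef j, y.coef j⟫_ℝ) ⟪toL2 x, toL2 y⟫_ℝ := by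
  refine (y.coef_spec.2.2.mapL (innerSL ℝ (toL2 x))).congr_fun fun j => ?_
  rw [innerSL_apply_apply, real_inner_comm, real_inner_comm (mode n j (y.coef j))]
  exact inner_coeff _ _ _

theorem hasSum_norm_sq_toL2 (x : E n) : HasSum (fun j => ‖x.coef j‖ ^ 2) (‖toL2 x‖ ^ 2) := by
  simpa only [real_inner_self_eq_norm_sq] using hasSum_inner_toL2 x x

theorem norm_toL2_le (x : E n) : ‖toL2 x‖ ≤ ‖x‖ := by
  refine (sq_le_sq₀ (norm_nonneg _) (norm_nonneg _)).1 ?_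
  refine hasSum_le (fun j => ?_) (hasSum_norm_sq_toL2 x) (hasSum_norm_sq x)
  exact le_mul_of_one_le_left (sq_nonneg _) (one_le_weight j)

theorem norm_coef_le (x : E n) (j : ℤ) : ‖x.coef j‖ ≤ ‖x‖ := by
  refine le_trans ?_ (norm_toL2_le x)
  refine (sq_le_sq₀ (norm_nonneg _) (norm_nonneg _)).1 ?_
  exact le_hasSum (hasSum_norm_sq_toL2 x) j fun _ _ => sq_nonneg _

/-- The inclusion `𝔼 ⊆ L²(S¹; ℝ²ⁿ)` as a continuous linear map. -/
noncomputable def toL2L (n : ℕ) : E n →L[ℝ] L2Loop n :=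
  toL2.mkContinuous 1 fun x => by simpa using norm_toL2_le x

theorem coef_part (A : Set ℤ) (x : E n) (j : ℤ) : (x.part A).coef j = A.indicator x.coef j := by
  have h : HasSum (fun j : ℤ => mode n j (A.indicator x.coef j)) (toL2 (x.part A)) := by
    refine Summable.hasSum ((x.coef_spec.2.2.summable.indicator A).congr fun j => ?_)
    by_cases hj : j ∈ A <;> simp [hj]
  exact congrFun (coeff_eq_of_hasSum h) j

theorem coef_part_of_mem {A : Set ℤ} (x : E n) {j : ℤ} (hj : j ∈ A) :
    (x.part A).coef j = x.coef j := by rw [coef_part, indicator_of_mem hj]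

theorem coef_part_of_notMem {A : Set ℤ} (x : E n) {j : ℤ} (hj : j ∉ A) :
    (x.part A).coef j = 0 := by rw [coef_part, indicator_of_notMem hj]

theorem coef_plus (x : E n) (j : ℤ) : x.plus.coef j = if 0 < j then x.coef j else 0 :=
  (coef_part _ x j).trans (by simp [indicator_apply])

theorem coef_zeroPart (x : E n) (j : ℤ) : x.zero.coef j = if j = 0 then x.coef j else 0 :=
  (coef_part _ x j).trans (by simp [indicator_apply])

theorem coef_minus (x : E n) (j : ℤ) : x.minus.coef j = if j < 0 then x.coef j else 0 :=
  (coef_part _ x j).trans (by simp [indicator_apply])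

theorem hasSum_norm_sq_part (A : Set ℤ) (x : E n) :
    HasSum (A.indicator fun j => weight j * ‖x.coef j‖ ^ 2) (‖x.part A‖ ^ 2) := by
  refine (hasSum_norm_sq (x.part A)).congr_fun fun j => ?_
  by_cases hj : j ∈ A
  · rw [indicator_of_mem hj, coef_part_of_mem x hj]
  · simp [indicator_of_notMem hj, coef_part_of_notMem x hj]

theorem norm_part_le (A : Set ℤ) (x : E n) : ‖x.part A‖ ≤ ‖x‖ := by
  refine (sq_le_sq₀ (norm_nonneg _) (norm_nonneg _)).1 ?_
  refine hasSum_le (fun j => ?_) (hasSum_norm_sq_part A x) (hasSum_norm_sq x)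
  exact indicator_le_self' (fun _ _ => mul_nonneg (weight_pos _).le (sq_nonneg _)) j

/-- The projection `x ↦ x.part A` as a continuous linear map. -/
noncomputable def partL (n : ℕ) (A : Set ℤ) : E n →L[ℝ] E n :=
  LinearMap.mkContinuous
    { toFun := part A
      map_add' := fun x y => ext_coef fun j => by
        by_cases hj : j ∈ A
        · simp only [coef_add, coef_part_of_mem _ hj]
        · simp only [coef_add, coef_part_of_notMem _ hj, add_zero]
      map_smul' := fun r x => ext_coef fun j => by
        by_cases hj : j ∈ A
        · simp only [coef_smul, coef_part_of_mem _ hj, RingHom.id_apply]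
        · simp only [coef_smul, coef_part_of_notMem _ hj, RingHom.id_apply, smul_zero] }
    1 fun x => by simpa using norm_part_le A x

theorem partL_apply (A : Set ℤ) (x : E n) : partL n A x = x.part A := rfl

theorem inner_part_left (A : Set ℤ) (x y : E n) : ⟪x.part A, y⟫_ℝ = ⟪x, y.part A⟫_ℝ := by
  refine (hasSum_inner (x.part A) y).unique ((hasSum_inner x (y.part A)).congr_fun fun j => ?_)
  by_cases hj : j ∈ A
  · rw [coef_part_of_mem _ hj, coef_part_of_mem _ hj]
  · rw [coef_part_of_notMem _ hj, coef_part_of_notMem _ hj, inner_zero_left, inner_zero_right]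

theorem isSelfAdjoint_partL [CompleteSpace (E n)] (A : Set ℤ) : IsSelfAdjoint (partL n A) :=
  (ContinuousLinearMap.isSelfAdjoint_iff_isSymmetric (A := partL n A)).2 (inner_part_left A)

theorem part_part (A B : Set ℤ) (x : E n) : (x.part A).part B = x.part (B ∩ A) := by
  refine ext_coef fun j => ?_
  rw [coef_part, coef_part, ← indicator_indicator]
  congr 1
  funext k
  exact coef_part A x k

theorem sub_part (A : Set ℤ) (x : E n) : x - x.part A = x.part Aᶜ := by
  refine ext_coef fun j => ?_
  rw [coef_sub, coef_part, coef_part, sub_eq_iff_eq_add']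
  exact (indicator_self_add_compl_apply A x.coef j).symm

theorem part_mem_supportedOn (A : Set ℤ) (x : E n) : x.part A ∈ supportedOn n A :=
  fun _ hj => coef_part_of_notMem x hj

theorem part_eq_self_iff {A : Set ℤ} {x : E n} : x.part A = x ↔ x ∈ supportedOn n A := by
  refine ⟨fun h => h ▸ part_mem_supportedOn A x, fun h => ext_coef fun j => ?_⟩
  by_cases hj : j ∈ A
  · exact coef_part_of_mem x hj
  · rw [coef_part_of_notMem x hj, h j hj]

theorem plus_add_zero_add_minus (x : E n) : x.plus + x.zero + x.minus = x := by
  refine ext_coef fun j => ?_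
  rw [coef_add, coef_add, coef_plus, coef_zeroPart, coef_minus]
  rcases lt_trichotomy j 0 with h | h | h
  · simp [h, h.ne, h.not_gt]
  · simp [h]
  · simp [h, h.ne', h.not_gt]

theorem norm_sq_eq (x : E n) : ‖x‖ ^ 2 = ‖x.plus‖ ^ 2 + ‖x.zero‖ ^ 2 + ‖x.minus‖ ^ 2 := by
  refine (hasSum_norm_sq x).unique ((((hasSum_norm_sq_part {j | 0 < j} x).add
    (hasSum_norm_sq_part {0} x)).add (hasSum_norm_sq_part {j | j < 0} x)).congr_fun fun j => ?_)
  rcases lt_trichotomy j 0 with h | h | h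
  · simp [h, h.ne, h.not_gt]
  · simp [h]
  · simp [h, h.ne', h.not_gt]

theorem norm_zero_le_norm_toL2 (x : E n) : ‖x.zero‖ ≤ ‖toL2 x‖ := by
  refine (sq_le_sq₀ (norm_nonneg _) (norm_nonneg _)).1 ?_
  refine hasSum_le (fun j => ?_) (hasSum_norm_sq_part {0} x) (hasSum_norm_sq_toL2 x)
  refine indicator_apply_le' (fun hj => ?_) fun _ => sq_nonneg _
  rw [mem_singleton_iff.1 hj, weight, if_pos rfl, one_mul]

theorem mem_Eminus_sup_Ezero_iff {x : E n} : x ∈ Eminus n ⊔ Ezero n ↔ x.plus = 0 := by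
  constructor
  · rw [Submodule.mem_sup]
    rintro ⟨y, hy, z, hz, rfl⟩
    refine ext_coef fun j => ?_
    rw [coef_zero, coef_plus, coef_add]
    refine ite_eq_right_iff.2 fun hj => ?_
    rw [hy j hj.not_gt, hz j hj.ne', add_zero]
  · intro h
    have hx := plus_add_zero_add_minus x
    rw [h, zero_add, add_comm] at hx
    rw [← hx]
    exact Submodule.add_mem_sup (part_mem_supportedOn _ x) (part_mem_supportedOn _ x)

theorem exists_coef_eq {c : ℤ → Phase n} (hc : ∀ j, c j ∈ L0 n)
    (hs : Summable fun j : ℤ => weight j * ‖c j‖ ^ 2) : ∃ x : E n, x.coef = c := by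
  have hsq : Summable fun j => ‖c j‖ ^ 2 := Summable.of_nonneg_of_le (fun j => sq_nonneg _)
    (fun j => le_mul_of_one_le_left (sq_nonneg _) (one_le_weight j)) hs
  have habs : Summable fun j : ℤ => |(j : ℝ)| * ‖c j‖ ^ 2 :=
    Summable.of_nonneg_of_le (fun j => by positivity)
      (fun j => mul_le_mul_of_nonneg_right (abs_le_weight j) (sq_nonneg _)) hs
  have hmode : Summable fun j => mode n j (c j) :=
    ((orthogonalFamily_modeIsometry n).summable_iff_norm_sq_summable c).2 hsq
  exact ⟨⟨∑' j, mode n j (c j), c, hc, habs, hmode.hasSum⟩, coeff_eq_of_hasSum hmode.hasSum⟩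

/-- The isometric identification of `𝔼` with `ℓ²(ℤ; L₀)`, given by `x ↦ (√(weight j) x_j)_j`. -/
noncomputable def toSeq (n : ℕ) : E n →ₗᵢ[ℝ] lp (fun _ : ℤ => L0 n) 2 where
  toFun x := ⟨fun j => √(weight j) • ⟨x.coef j, x.coef_spec.1 j⟩, by
    refine memℓp_gen ((hasSum_norm_sq x).summable.congr fun j => ?_)
    rw [norm_smul, Real.norm_of_nonneg (Real.sqrt_nonneg _), ENNReal.toReal_ofNat,
      Real.rpow_ofNat, mul_pow, Real.sq_sqrt (weight_pos j).le]
    rfl⟩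
  map_add' x y := by
    refine Subtype.ext (funext fun j => Subtype.ext ?_)
    change √(weight j) • (x + y).coef j = √(weight j) • x.coef j + √(weight j) • y.coef j
    rw [coef_add, smul_add]
  map_smul' r x := by
    refine Subtype.ext (funext fun j => Subtype.ext ?_)
    change √(weight j) • (r • x).coef j = r • √(weight j) • x.coef j
    rw [coef_smul, smul_comm]
  norm_map' x := by
    refine (sq_eq_sq₀ (norm_nonneg _) (norm_nonneg _)).1 ?_
    rw [← real_inner_self_eq_norm_sq]
    refine (lp.hasSum_inner _ _).unique ((hasSum_norm_sq x).congr_fun fun j => ?_)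
    rw [real_inner_self_eq_norm_sq]
    change ‖√(weight j) • (⟨x.coef j, x.coef_spec.1 j⟩ : L0 n)‖ ^ 2 = _
    rw [norm_smul, Real.norm_of_nonneg (Real.sqrt_nonneg _), mul_pow,
      Real.sq_sqrt (weight_pos j).le]
    rfl

theorem toSeq_surjective : Function.Surjective (toSeq n) := by
  intro f
  have hs : ∀ j, weight j * ‖(√(weight j))⁻¹ • (f j : Phase n)‖ ^ 2 = ⟪f j, f j⟫_ℝ := by
    intro j
    rw [real_inner_self_eq_norm_sq, norm_smul, norm_inv, Real.norm_of_nonneg (Real.sqrt_nonneg _),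
      mul_pow, inv_pow, Real.sq_sqrt (weight_pos j).le, mul_inv_cancel_left₀ (weight_pos j).ne']
    rfl
  obtain ⟨x, hx⟩ := exists_coef_eq (c := fun j => (√(weight j))⁻¹ • (f j : Phase n))
    (fun j => (L0 n).smul_mem _ (f j).2) ((lp.summable_inner f f).congr fun j => (hs j).symm)
  refine ⟨x, Subtype.ext (funext fun j => Subtype.ext ?_)⟩
  change √(weight j) • x.coef j = f j
  rw [hx, smul_inv_smul₀ (Real.sqrt_pos.2 (weight_pos j)).ne']

instance : CompleteSpace (E n) :=
  let e := LinearIsometryEquiv.ofSurjective (toSeq n) toSeq_surjective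
  (completeSpace_congr (e := e.toEquiv) e.isometry.isUniformEmbedding).2 inferInstance

/-- The element `t ↦ e^{2πjtJ₀} v` of `𝔼`, for `v ∈ L₀`. -/
noncomputable def single (j : ℤ) (v : L0 n) : E n :=
  ⟨mode n j v, fun k => if j = k then (v : Phase n) else 0, fun k => by
    dsimp only
    split_ifs
    · exact v.2
    · exact (L0 n).zero_mem, by
    refine summable_of_ne_finset_zero (s := {j}) fun k hk => ?_
    dsimp only
    rw [if_neg (by simpa [eq_comm] using hk), norm_zero, zero_pow two_ne_zero, mul_zero], by
    have h := hasSum_single (f := fun k => mode n k (if j = k then (v : Phase n) else 0)) j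
      fun k hk => by rw [if_neg hk.symm, map_zero]
    rwa [if_pos rfl] at h⟩

theorem toL2_single (j : ℤ) (v : L0 n) : toL2 (single j v) = mode n j v := rfl

theorem coef_single (j : ℤ) (v : L0 n) (k : ℤ) :
    (single j v).coef k = if j = k then (v : Phase n) else 0 := by
  rw [coef, toL2_single, coeff_mode]

theorem inner_single_left (j : ℤ) (v : L0 n) (x : E n) :
    ⟪single j v, x⟫_ℝ = weight j * ⟪(v : Phase n), x.coef j⟫_ℝ := by
  refine (hasSum_inner (single j v) x).unique ((hasSum_ite_eq j _).congr_fun fun k => ?_)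
  rw [coef_single]
  by_cases hk : k = j
  · simp [hk]
  · simp [hk, Ne.symm hk]

theorem toL2_part (A : Finset ℤ) (x : E n) :
    toL2 (x.part A) = ∑ j ∈ A, mode n j (x.coef j) := by
  refine (x.part A).coef_spec.2.2.unique ?_
  rw [Finset.sum_congr rfl fun j hj => by
    rw [← coef_part_of_mem (A := ↑A) x (Finset.mem_coe.2 hj)]]
  refine hasSum_sum_of_ne_finset_zero fun j hj => ?_
  rw [coef_part_of_notMem x (by simpa using hj), map_zero]

theorem ae_norm_toL2_part_le (A : Finset ℤ) (x : E n) :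
    ∀ᵐ t, ‖toL2 (x.part A) t‖ ≤ A.card * ‖x‖ := by
  let f : C(UnitAddCircle, Phase n) :=
    ∑ j ∈ A, ⟨fun t => rot n j t (x.coef j), continuous_rot n j _⟩
  have hf : toL2 (x.part A) = ContinuousMap.toLp 2 volume ℝ f := by
    rw [toL2_part, map_sum]
    rfl
  rw [hf]
  filter_upwards [ContinuousMap.coeFn_toLp (𝕜 := ℝ) (p := 2) volume f] with t ht
  rw [ht, ContinuousMap.sum_apply, ← nsmul_eq_mul]
  refine norm_sum_le_of_le _ (fun j _ => ?_) |>.trans_eq (Finset.sum_const _)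
  exact (norm_rot j t _).trans_le (norm_coef_le x j)

theorem tendsto_part (x : E n) :
    Tendsto (fun A : Finset ℤ => x.part A) atTop (𝓝 x) := by
  have hpart : ∀ A : Finset ℤ, ‖x.part A‖ ^ 2 = ∑ j ∈ A, weight j * ‖x.coef j‖ ^ 2 := fun A => by
    refine (hasSum_norm_sq_part A x).unique ?_
    rw [← Finset.sum_indicator_subset _ (Finset.Subset.refl A)]
    exact hasSum_sum_of_ne_finset_zero fun j hj => indicator_of_notMem (by simpa using hj) _
  have hsub : ∀ A : Finset ℤ, ‖x.part A - x‖ ^ 2 = ‖x‖ ^ 2 - ‖x.part A‖ ^ 2 := fun A => by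
    rw [norm_sub_rev, sub_part]
    refine (hasSum_norm_sq_part _ x).unique
      (((hasSum_norm_sq x).sub (hasSum_norm_sq_part A x)).congr_fun fun j => ?_)
    rw [indicator_compl, Pi.sub_apply]
  have hsq : Tendsto (fun A : Finset ℤ => ‖x.part A - x‖ ^ 2) atTop (𝓝 0) := by
    simp only [hsub, hpart]
    have h := Tendsto.const_sub (‖x‖ ^ 2) (hasSum_norm_sq x)
    rwa [sub_self] at h
  rw [tendsto_iff_norm_sub_tendsto_zero]
  simpa [Real.sqrt_sq] using hsq.sqrt

instance finiteDimensional_supportedOn (A : Set ℤ) [Finite A] :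
    FiniteDimensional ℝ (supportedOn n A) := by
  let T : supportedOn n A →ₗ[ℝ] (A → Phase n) :=
    { toFun := fun x j => (x : E n).coef j
      map_add' := fun x y => funext fun j => coef_add _ _ _
      map_smul' := fun r x => funext fun j => coef_smul _ _ _ }
  refine FiniteDimensional.of_injective T fun x y hxy => Subtype.ext (ext_coef fun j => ?_)
  by_cases hj : j ∈ A
  · exact congrFun hxy ⟨j, hj⟩
  · rw [x.2 j hj, y.2 j hj]

theorem isCompactOperator_partL (A : Set ℤ) [Finite A] : IsCompactOperator (partL n A) := by
  have h : IsCompactOperator ((partL n A).codRestrict (supportedOn n A)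
      (part_mem_supportedOn A)) := by
    have : ProperSpace (supportedOn n A) := FiniteDimensional.proper_real _
    exact isCompactOperator_of_locallyCompactSpace_dom _
  exact h.clm_comp (supportedOn n A).subtypeL

/-- The modes of frequency at most `N` in absolute value. -/
noncomputable def lowModes (N : ℕ) : Finset ℤ := Finset.Icc (-N) N

theorem tendsto_lowModes : Tendsto lowModes atTop atTop := Finset.tendsto_Icc_neg (R := ℤ)

theorem norm_toL2_sub_part_lowModes_sq_le (N : ℕ) (x : E n) :
    ‖toL2 (x - x.part (lowModes N))‖ ^ 2 ≤ ‖x‖ ^ 2 / (N + 1) := by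
  rw [sub_part]
  refine hasSum_le (fun j => ?_) (hasSum_norm_sq_toL2 _) ((hasSum_norm_sq x).div_const _)
  by_cases hj : j ∈ lowModes N
  · rw [coef_part_of_notMem _ (by simpa using hj), norm_zero, zero_pow two_ne_zero]
    have := weight_pos j
    positivity
  · rw [coef_part_of_mem _ (by simpa using hj), le_div_iff₀ (by positivity), mul_comm]
    refine mul_le_mul_of_nonneg_right (le_trans ?_ (abs_le_weight j)) (sq_nonneg _)
    have h : (N : ℤ) + 1 ≤ |j| := by
      by_contra hlt
      exact hj (by rw [lowModes, Finset.mem_Icc, ← abs_le]; omega)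
    rw [← Int.cast_abs]
    exact_mod_cast h

/-- The adjoint `L² → 𝔼` of the inclusion. -/
noncomputable def adjL (n : ℕ) : L2Loop n →L[ℝ] E n := ContinuousLinearMap.adjoint (toL2L n)

theorem inner_adjL_left (f : L2Loop n) (y : E n) : ⟪adjL n f, y⟫_ℝ = ⟪f, toL2 y⟫_ℝ :=
  ContinuousLinearMap.adjoint_inner_left _ _ _

theorem norm_adjL_le (f : L2Loop n) : ‖adjL n f‖ ≤ ‖f‖ := by
  refine ((adjL n).le_of_opNorm_le ?_ f).trans_eq (one_mul _)
  rw [adjL, LinearIsometryEquiv.norm_map]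
  exact LinearMap.mkContinuous_norm_le _ zero_le_one _

theorem tendsto_toL2L_comp_partL :
    Tendsto (fun N : ℕ => (toL2L n).comp (partL n (lowModes N))) atTop (𝓝 (toL2L n)) := by
  have hlim : Tendsto (fun N : ℕ => √(1 / ((N : ℝ) + 1))) atTop (𝓝 0) := by
    simpa using (tendsto_one_div_add_atTop_nhds_zero_nat (𝕜 := ℝ)).sqrt
  refine (tendsto_iff_norm_sub_tendsto_zero (E := E n →L[ℝ] L2Loop n)).2
    (squeeze_zero (fun _ => ContinuousLinearMap.opNorm_nonneg _) (fun N => ?_) hlim)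
  refine ContinuousLinearMap.opNorm_le_bound _ (Real.sqrt_nonneg _) fun x => ?_
  refine (sq_le_sq₀ (norm_nonneg _) (by positivity)).1 ?_
  rw [mul_pow, Real.sq_sqrt (by positivity), one_div, inv_mul_eq_div]
  refine le_of_eq_of_le ?_ (norm_toL2_sub_part_lowModes_sq_le N x)
  rw [map_sub, norm_sub_rev]
  rfl

theorem isCompactOperator_adjL : IsCompactOperator (adjL n) := by
  have hlim : Tendsto (fun N : ℕ => (partL n (lowModes N)).comp (adjL n)) atTop (𝓝 (adjL n)) := by
    refine ((ContinuousLinearMap.adjoint.continuous.tendsto _).comp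
      (tendsto_toL2L_comp_partL (n := n))).congr fun N => ?_
    rw [Function.comp_apply, ContinuousLinearMap.adjoint_comp, (isSelfAdjoint_partL _).adjoint_eq,
      adjL]
  exact isCompactOperator_of_tendsto hlim (Eventually.of_forall fun N =>
    (isCompactOperator_partL _).comp_clm (adjL n))

end E

end Modes

section Superposition

open Filter
open scoped NNReal

variable {α V W : Type*} [MeasurableSpace α] {μ : Measure α} [IsFiniteMeasure μ]
  {p : ENNReal} [NormedAddCommGroup V] [NormedAddCommGroup W] {g : V → W} {M : ℝ≥0}

theorem lipschitzWith_sub_const (hg : LipschitzWith M g) (c : W) :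
    LipschitzWith M fun z => g z - c :=
  LipschitzWith.of_dist_le_mul fun z w => (dist_sub_right _ _ c).trans_le (hg.dist_le_mul z w)

/-- The superposition operator `f ↦ g ∘ f` on the `Lᵖ` space of a finite measure. The constant
`g 0` is split off because `LipschitzWith.compLp` is available for maps fixing `0` only. -/
noncomputable def superposition (hg : LipschitzWith M g) (f : Lp V p μ) : Lp W p μ :=
  (lipschitzWith_sub_const hg (g 0)).compLp (sub_self _) f + Lp.const p μ (g 0)

theorem coeFn_superposition (hg : LipschitzWith M g) (f : Lp V p μ) :
    superposition hg f =ᵐ[μ] fun t => g (f t) := by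
  have hg₀ := lipschitzWith_sub_const hg (g 0)
  filter_upwards [Lp.coeFn_add (hg₀.compLp (sub_self _) f) (Lp.const p μ (g 0)),
    hg₀.coeFn_compLp (sub_self _) f, Lp.coeFn_const p μ (g 0)] with t hadd hcomp hconst
  rw [superposition, hadd, Pi.add_apply, hcomp, hconst]
  exact sub_add_cancel _ _

theorem norm_superposition_sub_le (hg : LipschitzWith M g) (f f' : Lp V p μ) :
    ‖superposition hg f - superposition hg f'‖ ≤ M * ‖f - f'‖ := by
  rw [superposition, superposition, add_sub_add_right_eq_sub]
  exact (lipschitzWith_sub_const hg (g 0)).norm_compLp_sub_le (sub_self _) f f'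

theorem norm_superposition_sub_smul_le [NormedSpace ℝ V] {μ : Measure α} [IsProbabilityMeasure μ]
    {g : V → V} (hg : LipschitzWith M g) {c C : ℝ} (hC : ∀ z, ‖g z - c • z‖ ≤ C) (f : Lp V p μ) :
    ‖superposition hg f - c • f‖ ≤ C := by
  have hbound : ∀ᵐ t ∂μ, ‖(superposition hg f - c • f) t‖ ≤ C := by
    filter_upwards [Lp.coeFn_sub (superposition hg f) (c • f), Lp.coeFn_smul c f,
      coeFn_superposition hg f] with t hsub hsmul hsup
    rw [hsub, Pi.sub_apply, hsmul, Pi.smul_apply, hsup]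
    exact hC (f t)
  have h := Lp.norm_le_of_ae_bound ((norm_nonneg _).trans (hC 0)) hbound
  simpa [measureUnivNNReal] using h

end Superposition

section LipschitzGradient

open Filter Topology
open scoped NNReal

variable {α V : Type*} [MeasurableSpace α] {μ : Measure α} [NormedAddCommGroup V]
  [InnerProductSpace ℝ V]

theorem integrable_norm_sq (f : Lp V 2 μ) : Integrable (fun t => ‖f t‖ ^ 2) μ := by
  simpa only [real_inner_self_eq_norm_sq] using L2.integrable_inner (𝕜 := ℝ) f f

theorem integral_norm_sq (f : Lp V 2 μ) : ∫ t, ‖f t‖ ^ 2 ∂μ = ‖f‖ ^ 2 := by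
  simp only [← real_inner_self_eq_norm_sq, L2.inner_def]

variable [CompleteSpace V] {F : V → ℝ} {M : ℝ≥0}

theorem abs_sub_sub_inner_gradient_le (hF : Differentiable ℝ F) (hM : LipschitzWith M (gradient F))
    (z w : V) : |F (z + w) - F z - ⟪gradient F z, w⟫_ℝ| ≤ M * ‖w‖ ^ 2 := by
  have h := (convex_closedBall z ‖w‖).norm_image_sub_le_of_norm_hasFDerivWithin_le'
    (f := F) (φ := InnerProductSpace.toDual ℝ V (gradient F z)) (C := M * ‖w‖) (y := z + w)
    (fun x _ => (hF x).hasGradientAt.hasFDerivAt.hasFDerivWithinAt) (fun x hx => ?_)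
    (Metric.mem_closedBall_self (norm_nonneg _)) (by simp)
  · rwa [add_sub_cancel_left, InnerProductSpace.toDual_apply_apply, Real.norm_eq_abs, mul_assoc,
      ← sq] at h
  · rw [← map_sub, LinearIsometryEquiv.norm_map, ← dist_eq_norm]
    exact (hM.dist_le_mul x z).trans (mul_le_mul_of_nonneg_left hx M.coe_nonneg)

theorem apply_add_le_of_eventuallyEq_zero (hF : Differentiable ℝ F)
    (hM : LipschitzWith M (gradient F)) {z : V} (hz : F =ᶠ[𝓝 z] 0) (w : V) :
    F (z + w) ≤ M * ‖w‖ ^ 2 := by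
  have hgrad : gradient F z = 0 := hz.gradient_eq.trans (gradient_const z 0)
  have h := (abs_le.1 (abs_sub_sub_inner_gradient_le hF hM z w)).2
  rwa [hgrad, inner_zero_left, hz.self_of_nhds, Pi.zero_apply, sub_zero, sub_zero] at h

variable [IsFiniteMeasure μ]

theorem integrable_comp_add (hF : Differentiable ℝ F) (hM : LipschitzWith M (gradient F)) (z : V)
    (f : Lp V 2 μ) : Integrable (fun t => F (z + f t)) μ := by
  have hf : Integrable (fun t => ⟪gradient F z, f t⟫_ℝ) μ :=
    ((Lp.memLp f).integrable one_le_two).const_inner _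
  have hrem : Integrable (fun t => F (z + f t) - F z - ⟪gradient F z, f t⟫_ℝ) μ := by
    refine ((integrable_norm_sq f).const_mul (M : ℝ)).mono' ?_
      (Eventually.of_forall fun t => abs_sub_sub_inner_gradient_le hF hM z (f t))
    exact ((hF.continuous.comp_aestronglyMeasurable (aestronglyMeasurable_const.add
      (Lp.aestronglyMeasurable f))).sub aestronglyMeasurable_const).sub hf.aestronglyMeasurable
  refine ((hrem.add hf).add (integrable_const (F z))).congr (Eventually.of_forall fun t => ?_)
  simp only [Pi.add_apply]
  ring

theorem integrable_comp (hF : Differentiable ℝ F) (hM : LipschitzWith M (gradient F))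
    (f : Lp V 2 μ) : Integrable (fun t => F (f t)) μ := by
  simpa only [zero_add] using integrable_comp_add hF hM 0 f

theorem abs_integral_sub_sub_inner_le (hF : Differentiable ℝ F) (hM : LipschitzWith M (gradient F))
    (f w : Lp V 2 μ) :
    |(∫ t, F ((f + w) t) ∂μ) - (∫ t, F (f t) ∂μ) - ⟪superposition hM f, w⟫_ℝ| ≤ M * ‖w‖ ^ 2 := by
  have hint := integrable_comp (μ := μ) hF hM
  rw [L2.inner_def, ← integral_sub' (hint _) (hint f),
    ← integral_sub' ((hint _).sub (hint f)) (L2.integrable_inner (𝕜 := ℝ) _ _),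
    ← integral_norm_sq w, ← integral_const_mul, ← Real.norm_eq_abs]
  refine norm_integral_le_of_norm_le ((integrable_norm_sq w).const_mul _) ?_
  filter_upwards [Lp.coeFn_add f w, coeFn_superposition hM f] with t hadd hsup
  rw [Pi.sub_apply, Pi.sub_apply, hadd, hsup, Pi.add_apply]
  exact abs_sub_sub_inner_gradient_le hF hM (f t) (w t)

theorem mul_norm_sq_sub_le_integral {μ : Measure α} [IsProbabilityMeasure μ]
    (hF : Differentiable ℝ F) (hM : LipschitzWith M (gradient F)) {b D : ℝ}
    (hb : ∀ z, b * ‖z‖ ^ 2 - D ≤ F z) (f : Lp V 2 μ) : b * ‖f‖ ^ 2 - D ≤ ∫ t, F (f t) ∂μ := by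
  have hsq := (integrable_norm_sq f).const_mul b
  have h := integral_mono (hsq.sub (integrable_const D)) (integrable_comp hF hM f)
    fun t => hb (f t)
  rwa [integral_sub' hsq (integrable_const D), integral_const_mul, integral_norm_sq,
    integral_const, probReal_univ, one_smul] at h

/-- If `z + ε (u + v)` leaves the ball on which `F` vanishes although `u` is small, then `v`
dominates `u`. -/
theorem apply_add_smul_add_le (hF : Differentiable ℝ F) (hM : LipschitzWith M (gradient F))
    {z : V} {r : ℝ} (hr : 0 < r) (hz : EqOn F 0 (Metric.ball z r)) {D ε : ℝ} (hε : 0 < ε)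
    (hεD : ε * (2 * D) ≤ r) {u : V} (hu : ‖u‖ ≤ D) (v : V) :
    F (z + ε • (u + v)) ≤ 4 * M * ε ^ 2 * ‖v‖ ^ 2 := by
  rcases lt_or_ge ‖ε • (u + v)‖ r with hlt | hge
  · rw [hz (by simpa using hlt), Pi.zero_apply]
    positivity
  have hsmall := apply_add_le_of_eventuallyEq_zero hF hM
    (hz.eventuallyEq_of_mem (Metric.ball_mem_nhds z hr)) (ε • (u + v))
  rw [norm_smul, Real.norm_of_nonneg hε.le] at hge hsmall
  have hD : 2 * D ≤ ‖u + v‖ := le_of_mul_le_mul_left (hεD.trans hge) hε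
  have huv : ‖u + v‖ ≤ 2 * ‖v‖ := by linarith [norm_add_le u v]
  calc F (z + ε • (u + v)) ≤ M * (ε * ‖u + v‖) ^ 2 := hsmall
    _ ≤ M * (ε * (2 * ‖v‖)) ^ 2 := by gcongr
    _ = 4 * M * ε ^ 2 * ‖v‖ ^ 2 := by ring

/-- A substitute for the Sobolev embedding, which fails for `𝔼 ⊆ L^∞`: the low modes of `ε x` stay
in the zero set of `F`, and the high modes are small in `L²`. -/
theorem exists_integral_add_smul_le {n : ℕ} {F : Phase n → ℝ} (hF : Differentiable ℝ F)
    (hM : LipschitzWith M (gradient F)) {z : Phase n} (hz : F =ᶠ[𝓝 z] 0) {δ : ℝ} (hδ : 0 < δ) :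
    ∃ ε : ℝ, 0 < ε ∧ ∀ x : E n, ‖x‖ ≤ 1 → ∫ t, F (z + ε • E.toL2 x t) ≤ δ * ε ^ 2 := by
  obtain ⟨r, hr, hzr⟩ := Metric.eventually_nhds_iff_ball.1 hz
  obtain ⟨N, hN⟩ := exists_nat_ge (4 * M / δ)
  let A : Finset ℤ := E.lowModes N
  refine ⟨r / (2 * A.card + 1), by positivity, fun x hx => ?_⟩
  set ε := r / (2 * A.card + 1)
  have hε : 0 < ε := by positivity
  have hεA : ε * (2 * A.card) ≤ r := by
    rw [div_mul_eq_mul_div, div_le_iff₀ (by positivity)]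
    nlinarith
  set y := x - x.part A
  have hpt : ∀ᵐ t, F (z + ε • E.toL2 x t) ≤ 4 * M * ε ^ 2 * ‖E.toL2 y t‖ ^ 2 := by
    filter_upwards [E.ae_norm_toL2_part_le A x, Lp.coeFn_add (E.toL2 (x.part A)) (E.toL2 y)]
      with t hlow hadd
    rw [← map_add, add_sub_cancel, Pi.add_apply] at hadd
    rw [hadd]
    exact apply_add_smul_add_le hF hM hr hzr hε hεA
      (hlow.trans (mul_le_of_le_one_right (Nat.cast_nonneg _) hx)) _
  have hint : Integrable (fun t => F (z + ε • E.toL2 x t)) := by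
    refine (integrable_comp_add hF hM z (ε • E.toL2 x)).congr ?_
    filter_upwards [Lp.coeFn_smul ε (E.toL2 x)] with t ht
    rw [ht, Pi.smul_apply]
  calc ∫ t, F (z + ε • E.toL2 x t) ≤ ∫ t, 4 * M * ε ^ 2 * ‖E.toL2 y t‖ ^ 2 :=
        integral_mono_ae hint ((integrable_norm_sq _).const_mul _) hpt
    _ = 4 * M * ε ^ 2 * ‖E.toL2 y‖ ^ 2 := by rw [integral_const_mul, integral_norm_sq]
    _ ≤ 4 * M * ε ^ 2 * (1 / (N + 1)) := by
        gcongr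
        exact (E.norm_toL2_sub_part_lowModes_sq_le N x).trans
          (div_le_div_of_nonneg_right (pow_le_one₀ (norm_nonneg _) hx) (by positivity))
    _ ≤ δ * ε ^ 2 := by
        rw [mul_one_div, div_le_iff₀ (by positivity)]
        rw [div_le_iff₀ hδ] at hN
        nlinarith [sq_pos_of_pos hε]

end LipschitzGradient

section AsymptoticallyQuadratic

open scoped NNReal

/-- `H` is of class `C^{1,1}` (with Lipschitz constant `M` of the gradient) and its gradient is
within `C` of the gradient `2 a z` of `a |z|²`. -/
structure AsymptoticallyQuadratic {V : Type*} [NormedAddCommGroup V] [InnerProductSpace ℝ V]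
    [CompleteSpace V] (H : V → ℝ) (M : ℝ≥0) (C a : ℝ) : Prop where
  differentiable : Differentiable ℝ H
  lipschitz_gradient : LipschitzWith M (gradient H)
  norm_gradient_sub_le : ∀ z, ‖gradient H z - (2 * a) • z‖ ≤ C

theorem hasGradientAt_mul_norm_sq_add_inner_add {V : Type*} [NormedAddCommGroup V]
    [InnerProductSpace ℝ V] [CompleteSpace V] (a b : ℝ) (z₀ z : V) :
    HasGradientAt (fun z => a * ‖z‖ ^ 2 + ⟪z, z₀⟫_ℝ + b) ((2 * a) • z + z₀) z := by
  have h := (((hasFDerivAt_id z).norm_sq.const_mul a).add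
    ((hasFDerivAt_id z).inner ℝ (hasFDerivAt_const z₀ z))).add_const b
  rw [hasGradientAt_iff_hasFDerivAt]
  refine h.congr_fderiv (ContinuousLinearMap.ext fun w => ?_)
  simp only [id_eq, ContinuousLinearMap.comp_id, add_apply, smul_apply, coe_innerSL_apply,
    nsmul_eq_mul, Nat.cast_ofNat, smul_eq_mul, ContinuousLinearMap.comp_apply,
    ContinuousLinearMap.prod_apply, ContinuousLinearMap.id_apply, zero_apply, fderivInnerCLM_apply,
    inner_zero_right, real_inner_comm z₀ w, zero_add, map_add, map_smul,
    InnerProductSpace.toDual_apply_apply]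
  ring

theorem exists_lipschitzWith_gradient_and_bound {V : Type*} [NormedAddCommGroup V]
    [InnerProductSpace ℝ V] [CompleteSpace V] {f : V → ℝ} (hf : ContDiff ℝ 2 f)
    (hsupp : HasCompactSupport f) :
    ∃ (L : ℝ≥0) (C : ℝ), LipschitzWith L (gradient f) ∧ ∀ z, ‖gradient f z‖ ≤ C := by
  have hf' : ContDiff ℝ 1 (fderiv ℝ f) := hf.fderiv_right (by norm_num)
  obtain ⟨L, hL⟩ := hf'.lipschitzWith_of_hasCompactSupport (hsupp.fderiv ℝ) one_ne_zero
  obtain ⟨C, hC⟩ := (hsupp.fderiv ℝ).exists_bound_of_continuous hf'.continuous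
  refine ⟨L, C, ?_, fun z => (LinearIsometryEquiv.norm_map _ _).trans_le (hC z)⟩
  have h := (InnerProductSpace.toDual ℝ V).symm.lipschitz.comp hL
  rwa [one_mul] at h

theorem exists_asymptoticallyQuadratic {n : ℕ} {H : Phase n → ℝ} (hH : ContDiff ℝ 2 H)
    {z₀ : Phase n} {a b : ℝ} (hquad : EqQuadraticOutsideCompact H z₀ a b) :
    ∃ M C, AsymptoticallyQuadratic H M C a := by
  obtain ⟨K, hK, hHK⟩ := hquad
  let q : Phase n → ℝ := fun z => a * ‖z‖ ^ 2 + ⟪z, z₀⟫_ℝ + b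
  let f : Phase n → ℝ := fun z => H z - q z
  have hf : ContDiff ℝ 2 f := hH.sub (((contDiff_const.mul (contDiff_norm_sq ℝ)).add
    (contDiff_id.inner ℝ contDiff_const)).add contDiff_const)
  obtain ⟨L, C, hL, hC⟩ := exists_lipschitzWith_gradient_and_bound hf
    (HasCompactSupport.intro hK fun z hz => sub_eq_zero.2 (hHK z hz))
  have hgrad : gradient H = fun z => gradient f z + ((2 * a) • z + z₀) := gradient_eq fun z => by
    have h := (hf.differentiable two_ne_zero z).hasGradientAt.hasFDerivAt.add
      (hasGradientAt_mul_norm_sq_add_inner_add a b z₀ z).hasFDerivAt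
    rw [hasGradientAt_iff_hasFDerivAt, map_add]
    refine h.congr_of_eventuallyEq (Filter.Eventually.of_forall fun w => ?_)
    exact (sub_add_cancel (H w) (q w)).symm
  refine ⟨L + ‖2 * a‖₊, C + ‖z₀‖, hH.differentiable two_ne_zero, ?_, fun z => ?_⟩
  · rw [hgrad]
    have h := hL.add ((lipschitzWith_smul (2 * a)).add (LipschitzWith.const z₀))
    rwa [add_zero] at h
  · have hz : gradient H z - (2 * a) • z = gradient f z + z₀ := by
      rw [hgrad, add_sub_assoc, add_sub_cancel_left]
    rw [hz]
    exact (norm_add_le _ _).trans (add_le_add_left (hC z) _)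

theorem AsymptoticallyQuadratic.exists_mul_norm_sq_sub_le {V : Type*} [NormedAddCommGroup V]
    [InnerProductSpace ℝ V] [CompleteSpace V] {H : V → ℝ} {M : ℝ≥0} {C a b : ℝ}
    (h : AsymptoticallyQuadratic H M C a) (hb : b < a) :
    ∃ D, ∀ z, b * ‖z‖ ^ 2 - D ≤ H z := by
  have hlip : ∀ z, ‖(H z - a * ‖z‖ ^ 2) - (H 0 - a * ‖(0 : V)‖ ^ 2)‖ ≤ C * ‖z - 0‖ := fun z => by
    refine convex_univ.norm_image_sub_le_of_norm_hasFDerivWithin_le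
      (f := fun z => H z - a * ‖z‖ ^ 2)
      (f' := fun z => InnerProductSpace.toDual ℝ V (gradient H z - (2 * a) • z))
      (fun y _ => HasFDerivAt.hasFDerivWithinAt ?_)
      (fun y _ => (LinearIsometryEquiv.norm_map _ _).trans_le (h.norm_gradient_sub_le y))
      (mem_univ _) (mem_univ _)
    have hq := (hasGradientAt_mul_norm_sq_add_inner_add a 0 0 y).hasFDerivAt
    simp only [inner_zero_right, add_zero] at hq
    rw [map_sub]
    exact (h.differentiable y).hasGradientAt.hasFDerivAt.sub hq
  have hd : 0 < 4 * (a - b) := by linarith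
  refine ⟨C ^ 2 / (4 * (a - b)) - H 0, fun z => ?_⟩
  have hz := neg_le_of_abs_le (hlip z)
  rw [norm_zero, zero_pow two_ne_zero, mul_zero, sub_zero, sub_zero] at hz
  have hsq : C * ‖z‖ ≤ (a - b) * ‖z‖ ^ 2 + C ^ 2 / (4 * (a - b)) := by
    rw [← sub_le_iff_le_add', le_div_iff₀ hd]
    nlinarith [sq_nonneg (2 * (a - b) * ‖z‖ - C)]
  linarith

end AsymptoticallyQuadratic

section GradientOfAction

open Filter Topology
open scoped NNReal

variable {n : ℕ}

instance : IsProbabilityMeasure (volume : Measure UnitAddCircle) :=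
  ⟨UnitAddCircle.measure_univ⟩

namespace E

theorem plus_add (x y : E n) : (x + y).plus = x.plus + y.plus := map_add (partL n _) x y

theorem plus_smul (r : ℝ) (x : E n) : (r • x).plus = r • x.plus := map_smul (partL n _) r x

theorem minus_add (x y : E n) : (x + y).minus = x.minus + y.minus := map_add (partL n _) x y

theorem norm_part_add_sq (A : Set ℤ) (x y : E n) :
    ‖(x + y).part A‖ ^ 2 = ‖x.part A‖ ^ 2 + 2 * ⟪x.part A, y⟫_ℝ + ‖y.part A‖ ^ 2 := by
  rw [← partL_apply, map_add, norm_add_sq_real, partL_apply, partL_apply, ← inner_part_left,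
    part_eq_self_iff.2 (part_mem_supportedOn A x)]

theorem norm_plus_sub_minus_le (x : E n) : ‖x.plus - x.minus‖ ≤ ‖x‖ := by
  refine (sq_le_sq₀ (norm_nonneg _) (norm_nonneg _)).1 ?_
  refine hasSum_le (fun j => ?_) (hasSum_norm_sq _) (hasSum_norm_sq x)
  refine mul_le_mul_of_nonneg_left ?_ (weight_pos j).le
  rw [coef_sub, coef_plus, coef_minus]
  rcases lt_trichotomy j 0 with h | h | h
  · simp [h, h.not_gt]
  · simp [h]
  · simp [h, h.not_gt]

theorem weight_smul_coef_adjL_toL2 (x : E n) (j : ℤ) :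
    weight j • (adjL n (toL2 x)).coef j = x.coef j := by
  have hmem : weight j • (adjL n (toL2 x)).coef j - x.coef j ∈ L0 n :=
    (L0 n).sub_mem ((L0 n).smul_mem _ ((adjL n (toL2 x)).coef_spec.1 j)) (x.coef_spec.1 j)
  have horth : ∀ v : L0 n, ⟪(v : Phase n), weight j • (adjL n (toL2 x)).coef j⟫_ℝ =
      ⟪(v : Phase n), x.coef j⟫_ℝ := fun v => by
    rw [real_inner_smul_right, ← inner_single_left, real_inner_comm, inner_adjL_left,
      real_inner_comm, toL2_single]
    exact (inner_coeff _ _ _).symm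
  have h := horth ⟨_, hmem⟩
  rwa [← sub_eq_zero, ← inner_sub_right, inner_self_eq_zero, sub_eq_zero] at h

/-- The gradient `x⁺ - x⁻ - 2a ι* x` of the action functional of `z ↦ a |z|²`, where
`ι : 𝔼 → L²` is the inclusion. -/
noncomputable def quadraticGrad (n : ℕ) (a : ℝ) : E n →L[ℝ] E n :=
  partL n {j | 0 < j} - partL n {j | j < 0} - (2 * a) • (adjL n).comp (toL2L n)

theorem quadraticGrad_apply (a : ℝ) (x : E n) :
    quadraticGrad n a x = x.plus - x.minus - (2 * a) • adjL n (toL2 x) := rfl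

theorem weight_smul_coef_quadraticGrad (a : ℝ) (x : E n) (j : ℤ) :
    weight j • (quadraticGrad n a x).coef j = (2 * (Real.pi * j - a)) • x.coef j := by
  have hsign : weight j • (x.plus - x.minus).coef j = (2 * Real.pi * j) • x.coef j := by
    rw [coef_sub, coef_plus, coef_minus]
    rcases lt_trichotomy j 0 with h | rfl | h
    · have hj : |(j : ℝ)| = -j := abs_of_neg (by exact_mod_cast h)
      rw [if_neg h.not_gt, if_pos h, weight_of_ne h.ne, hj]
      module
    · simp
    · have hj : |(j : ℝ)| = j := abs_of_pos (by exact_mod_cast h)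
      rw [if_pos h, if_neg h.not_gt, weight_of_ne h.ne', hj, sub_zero]
  rw [quadraticGrad_apply, coef_sub, coef_smul, smul_sub, hsign, smul_comm,
    weight_smul_coef_adjL_toL2]
  module

theorem exists_mul_weight_le {a : ℝ} (hres : ∀ k : ℤ, a ≠ k * Real.pi) :
    ∃ δ : ℝ, 0 < δ ∧ ∀ j : ℤ, δ * weight j ≤ |2 * (Real.pi * j - a)| := by
  obtain ⟨d, hd, hgap⟩ : ∃ d : ℝ, 0 < d ∧ ∀ j : ℤ, d ≤ |2 * (Real.pi * j - a)| := by
    have hscale : ∀ j : ℤ, |2 * (Real.pi * j - a)| = 2 * Real.pi * |a / Real.pi - j| := fun j => by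
      have hfactor : 2 * (Real.pi * j - a) = -(2 * Real.pi * (a / Real.pi - j)) := by
        field_simp
        ring
      rw [hfactor, abs_neg, abs_mul, abs_of_pos Real.two_pi_pos]
    refine ⟨|2 * (Real.pi * round (a / Real.pi) - a)|, abs_pos.2 fun h => ?_, fun j => ?_⟩
    · exact hres (round (a / Real.pi)) (by linarith)
    · rw [hscale, hscale]
      exact mul_le_mul_of_nonneg_left (round_le _ j) Real.two_pi_pos.le
  refine ⟨d / (d + 1 + 2 * |a|), by positivity, fun j => ?_⟩
  have hweight : weight j ≤ 1 + 2 * |a| + |2 * (Real.pi * j - a)| := by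
    have htri := abs_add_le (2 * (Real.pi * j - a)) (2 * a)
    rw [abs_mul 2 a, abs_two, show 2 * (Real.pi * j - a) + 2 * a = 2 * Real.pi * j by ring] at htri
    by_cases hj : j = 0
    · rw [hj, weight, if_pos rfl]
      linarith [abs_nonneg a, abs_nonneg (2 * (Real.pi * ((0 : ℤ) : ℝ) - a))]
    · rw [abs_mul, abs_of_pos Real.two_pi_pos, ← weight_of_ne hj] at htri
      linarith
  rw [div_mul_eq_mul_div, div_le_iff₀ (by positivity)]
  nlinarith [mul_le_mul_of_nonneg_left hweight hd.le,
    mul_le_mul_of_nonneg_right (hgap j) (by positivity : 0 ≤ 1 + 2 * |a|)]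

theorem exists_mul_norm_le_norm_quadraticGrad {a : ℝ} (hres : ∀ k : ℤ, a ≠ k * Real.pi) :
    ∃ δ : ℝ, 0 < δ ∧ ∀ x : E n, δ * ‖x‖ ≤ ‖quadraticGrad n a x‖ := by
  obtain ⟨δ, hδ, hgap⟩ := exists_mul_weight_le hres
  refine ⟨δ, hδ, fun x => (sq_le_sq₀ (by positivity) (norm_nonneg _)).1 ?_⟩
  rw [mul_pow]
  refine hasSum_le (fun j => ?_) ((hasSum_norm_sq x).mul_left (δ ^ 2)) (hasSum_norm_sq _)
  have hj : δ * ‖x.coef j‖ ≤ ‖(quadraticGrad n a x).coef j‖ := by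
    refine le_of_mul_le_mul_left ?_ (weight_pos j)
    calc weight j * (δ * ‖x.coef j‖) = δ * weight j * ‖x.coef j‖ := by ring
      _ ≤ |2 * (Real.pi * j - a)| * ‖x.coef j‖ := by gcongr; exact hgap j
      _ = ‖weight j • (quadraticGrad n a x).coef j‖ := by
        rw [weight_smul_coef_quadraticGrad, norm_smul, Real.norm_eq_abs]
      _ = weight j * ‖(quadraticGrad n a x).coef j‖ := by
        rw [norm_smul, Real.norm_of_nonneg (weight_pos j).le]
  calc δ ^ 2 * (weight j * ‖x.coef j‖ ^ 2) = weight j * (δ * ‖x.coef j‖) ^ 2 := by ring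
    _ ≤ weight j * ‖(quadraticGrad n a x).coef j‖ ^ 2 :=
      mul_le_mul_of_nonneg_left (by gcongr) (weight_pos j).le

theorem exists_antilipschitzWith_quadraticGrad {a : ℝ} (hres : ∀ k : ℤ, a ≠ k * Real.pi) :
    ∃ K : ℝ≥0, AntilipschitzWith K (quadraticGrad n a) := by
  obtain ⟨δ, hδ, hbound⟩ := exists_mul_norm_le_norm_quadraticGrad (n := n) hres
  refine ⟨Real.toNNReal δ⁻¹, AddMonoidHomClass.antilipschitz_of_bound _ fun x => ?_⟩
  rw [Real.coe_toNNReal _ (by positivity), ← div_eq_inv_mul, le_div_iff₀ hδ, mul_comm]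
  exact hbound x

end E

open E

section LipschitzGradient

variable {H : Phase n → ℝ} {M : ℝ≥0}

theorem lipschitzWith_superposition_toL2 (hM : LipschitzWith M (gradient H)) :
    LipschitzWith M fun x : E n => superposition hM (toL2 x) := by
  refine LipschitzWith.of_dist_le_mul fun x y => ?_
  rw [dist_eq_norm, dist_eq_norm]
  refine (norm_superposition_sub_le hM _ _).trans ?_
  rw [← map_sub]
  exact mul_le_mul_of_nonneg_left (norm_toL2_le _) M.coe_nonneg

/-- The gradient `ι* (∇H ∘ x)` of `x ↦ ∫₀¹ H(x(t)) dt` with respect to `⟨·, ·⟩_{1/2}`, where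
`ι : 𝔼 → L²` is the inclusion. -/
noncomputable def gradPotential (hM : LipschitzWith M (gradient H)) (x : E n) : E n :=
  adjL n (superposition hM (toL2 x))

theorem lipschitzWith_gradPotential (hM : LipschitzWith M (gradient H)) :
    LipschitzWith M (gradPotential (n := n) hM) := by
  refine LipschitzWith.of_dist_le_mul fun x y => ?_
  rw [gradPotential, gradPotential, dist_eq_norm, ← map_sub]
  refine (norm_adjL_le _).trans ?_
  rw [← dist_eq_norm]
  exact (lipschitzWith_superposition_toL2 hM).dist_le_mul x y

theorem isCompact_closure_image_gradPotential (hM : LipschitzWith M (gradient H)) {B : Set (E n)}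
    (hB : Bornology.IsBounded B) : IsCompact (closure (gradPotential hM '' B)) := by
  have h := (isCompactOperator_adjL (n := n)).isCompact_closure_image_of_bounded
    (f := (adjL n : L2Loop n →ₗ[ℝ] E n)) ((lipschitzWith_superposition_toL2 hM).isBounded_image hB)
  rwa [image_image] at h

/-- The gradient of `Φ_H` with respect to `⟨·, ·⟩_{1/2}`. -/
noncomputable def gradAction (hM : LipschitzWith M (gradient H)) (x : E n) : E n :=
  x.plus - x.minus - gradPotential hM x

theorem abs_action_add_sub_sub_inner_le (hH : Differentiable ℝ H)
    (hM : LipschitzWith M (gradient H)) (x y : E n) :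
    |action H (x + y) - action H x - ⟪gradAction hM x, y⟫_ℝ| ≤ (M + 1) * ‖y‖ ^ 2 := by
  have hint := (abs_integral_sub_sub_inner_le hH hM (toL2 x) (toL2 y)).trans
    (mul_le_mul_of_nonneg_left (pow_le_pow_left₀ (norm_nonneg _) (norm_toL2_le y) 2) M.coe_nonneg)
  have hsplit : action H (x + y) - action H x - ⟪gradAction hM x, y⟫_ℝ =
      (‖y.plus‖ ^ 2 - ‖y.minus‖ ^ 2) / 2 - ((∫ t, H ((toL2 x + toL2 y) t)) -
        (∫ t, H (toL2 x t)) - ⟪superposition hM (toL2 x), toL2 y⟫_ℝ) := by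
    rw [action, action, gradAction, gradPotential, inner_sub_left, inner_sub_left,
      inner_adjL_left, map_add]
    simp only [plus, minus, norm_part_add_sq]
    ring
  have hy := norm_sq_eq y
  rw [hsplit]
  refine (abs_sub _ _).trans ?_
  have hquad : |(‖y.plus‖ ^ 2 - ‖y.minus‖ ^ 2) / 2| ≤ ‖y‖ ^ 2 := by
    rw [abs_le]
    constructor <;> nlinarith [sq_nonneg ‖y.plus‖, sq_nonneg ‖y.minus‖, sq_nonneg ‖y.zero‖]
  linarith

theorem hasGradientAt_action (hH : Differentiable ℝ H) (hM : LipschitzWith M (gradient H))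
    (x : E n) : HasGradientAt (action H) (gradAction hM x) x := by
  rw [hasGradientAt_iff_isLittleO_nhds_zero]
  have hO : (fun y => action H (x + y) - action H x - ⟪gradAction hM x, y⟫_ℝ) =O[𝓝 0]
      fun y : E n => ‖y‖ ^ 2 := by
    refine Asymptotics.IsBigO.of_bound (M + 1) (Eventually.of_forall fun y => ?_)
    rw [Real.norm_eq_abs, norm_pow, norm_norm]
    exact abs_action_add_sub_sub_inner_le hH hM x y
  exact hO.trans_isLittleO (Asymptotics.isLittleO_norm_pow_id one_lt_two)

theorem continuous_action (hH : Differentiable ℝ H) (hM : LipschitzWith M (gradient H)) :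
    Continuous (action H : E n → ℝ) :=
  continuous_iff_continuousAt.2 fun x =>
    (hasGradientAt_action hH hM x).hasFDerivAt.continuousAt

theorem isCriticalValue_of_gradAction_eq_zero (hH : Differentiable ℝ H)
    (hM : LipschitzWith M (gradient H)) {x : E n} (hx : gradAction hM x = 0) :
    IsCriticalValue H (action H x) := by
  have h := (hasGradientAt_action hH hM x).hasFDerivAt
  rw [hx, map_zero] at h
  exact ⟨x, h, rfl⟩

theorem lipschitzWith_gradAction (hM : LipschitzWith M (gradient H)) :
    LipschitzWith (1 + M) (gradAction (n := n) hM) := by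
  refine LipschitzWith.sub (LipschitzWith.of_dist_le_mul fun x y => ?_)
    (lipschitzWith_gradPotential hM)
  have hsplit : x.plus - x.minus - (y.plus - y.minus) = (x - y).plus - (x - y).minus := by
    simp only [plus, minus, ← partL_apply, map_sub]
    abel
  rw [dist_eq_norm, dist_eq_norm, hsplit, NNReal.coe_one, one_mul]
  exact norm_plus_sub_minus_le _

end LipschitzGradient

namespace AsymptoticallyQuadratic

variable {H : Phase n → ℝ} {M : ℝ≥0} {C a : ℝ}

theorem exists_isCompact_quadraticGrad_sub_gradAction_mem (h : AsymptoticallyQuadratic H M C a) :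
    ∃ K : Set (E n), IsCompact K ∧
      ∀ x, quadraticGrad n a x - gradAction h.lipschitz_gradient x ∈ K := by
  obtain ⟨K, hK, hsub⟩ := (isCompactOperator_adjL (n := n)).image_closedBall_subset_compact
    (f := (adjL n : L2Loop n →ₗ[ℝ] E n)) C
  refine ⟨K, hK, fun x => hsub
    ⟨superposition h.lipschitz_gradient (toL2 x) - (2 * a) • toL2 x, ?_, ?_⟩⟩
  · exact mem_closedBall_zero_iff.2 (norm_superposition_sub_smul_le _ h.norm_gradient_sub_le _)
  · rw [quadraticGrad_apply, gradAction, gradPotential, ContinuousLinearMap.coe_coe, map_sub,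
      map_smul]
    abel

theorem palaisSmale (h : AsymptoticallyQuadratic H M C a)
    (hres : ∀ k : ℤ, a ≠ k * Real.pi) {x : ℕ → E n}
    (hx : Tendsto (fun k => gradAction h.lipschitz_gradient (x k)) atTop (𝓝 0)) :
    ∃ z, ∃ φ : ℕ → ℕ, StrictMono φ ∧ Tendsto (fun k => x (φ k)) atTop (𝓝 z) := by
  obtain ⟨K, hK, hmem⟩ := h.exists_isCompact_quadraticGrad_sub_gradAction_mem
  obtain ⟨y, -, φ, hφ, hy⟩ := hK.tendsto_subseq fun k => hmem (x k)
  have hlim : Tendsto (fun k => quadraticGrad n a (x (φ k))) atTop (𝓝 y) := by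
    have := hy.add (hx.comp hφ.tendsto_atTop)
    rw [add_zero] at this
    exact this.congr fun k => sub_add_cancel _ _
  obtain ⟨L, hL⟩ := exists_antilipschitzWith_quadraticGrad (n := n) hres
  have huc := (quadraticGrad n a).uniformContinuous
  obtain ⟨z, rfl⟩ := (hL.isClosed_range huc).mem_of_tendsto hlim
    (Eventually.of_forall fun k => mem_range_self _)
  exact ⟨z, φ, hφ, (hL.isUniformEmbedding huc).isEmbedding.tendsto_nhds_iff.2 hlim⟩

theorem exists_le_norm_gradAction (h : AsymptoticallyQuadratic H M C a)
    (hres : ∀ k : ℤ, a ≠ k * Real.pi) {c : ℝ} (hc : ¬ IsCriticalValue H c) :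
    ∃ ε : ℝ, 0 < ε ∧
      ∀ x : E n, |action H x - c| < ε → ε ≤ ‖gradAction h.lipschitz_gradient x‖ := by
  by_contra! hcon
  have hpos : ∀ k : ℕ, (0 : ℝ) < 1 / ((k : ℝ) + 1) := fun k => by positivity
  choose x hxc hxg using fun k : ℕ => hcon _ (hpos k)
  have hlim : Tendsto (fun k : ℕ => 1 / ((k : ℝ) + 1)) atTop (𝓝 0) :=
    tendsto_one_div_add_atTop_nhds_zero_nat
  have hgrad := squeeze_zero_norm (fun k => (hxg k).le) hlim
  have hact : Tendsto (fun k => action H (x k)) atTop (𝓝 c) :=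
    tendsto_iff_norm_sub_tendsto_zero.2
      (squeeze_zero (fun k => norm_nonneg _) (fun k => (hxc k).le) hlim)
  obtain ⟨z, φ, hφ, hz⟩ := h.palaisSmale hres hgrad
  have hgz : gradAction h.lipschitz_gradient z = 0 := tendsto_nhds_unique
    (((lipschitzWith_gradAction _).continuous.tendsto z).comp hz) (hgrad.comp hφ.tendsto_atTop)
  have haz : action H z = c := tendsto_nhds_unique
    (((continuous_action h.differentiable h.lipschitz_gradient).tendsto z).comp hz)
    (hact.comp hφ.tendsto_atTop)
  exact hc (haz ▸ isCriticalValue_of_gradAction_eq_zero h.differentiable _ hgz)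

end AsymptoticallyQuadratic

end GradientOfAction

section Admissible

open Filter Topology
open scoped NNReal
open E

variable {n : ℕ}

/-- The coefficients `(a, b, c, k)` of a map `x ↦ a x⁺ + b x⁰ + c x⁻ + k` of the form (ii), with
`a, b, c > 0`. -/
abbrev Coeffs (n : ℕ) : Type := Ioi (0 : ℝ) × Ioi (0 : ℝ) × Ioi (0 : ℝ) × E n

namespace Coeffs

/-- The map `x ↦ a x⁺ + b x⁰ + c x⁻ + k` with the given coefficients. -/
noncomputable def eval (T : Coeffs n) (x : E n) : E n :=
  (T.1 : ℝ) • x.plus + (T.2.1 : ℝ) • x.zero + (T.2.2.1 : ℝ) • x.minus + T.2.2.2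

theorem coef_eval (T : Coeffs n) (x : E n) (j : ℤ) : (T.eval x).coef j =
    (if 0 < j then (T.1 : ℝ) else if j = 0 then (T.2.1 : ℝ) else (T.2.2.1 : ℝ)) • x.coef j +
      T.2.2.2.coef j := by
  simp only [eval, coef_add, coef_smul, coef_plus, coef_zeroPart, coef_minus]
  rcases lt_trichotomy j 0 with h | rfl | h
  · simp [h, h.ne, h.not_gt]
  · simp
  · simp [h, h.ne', h.not_gt]

theorem part_eval (T : Coeffs n) (x : E n) {A : Set ℤ} (hA : A ⊆ {j | 0 < j}) :
    (T.eval x).part A = (T.1 : ℝ) • x.part A + T.2.2.2.part A := ext_coef fun j => by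
  by_cases hj : j ∈ A
  · rw [coef_add, coef_smul, coef_part_of_mem _ hj, coef_part_of_mem _ hj, coef_part_of_mem _ hj,
      coef_eval, if_pos (show 0 < j from hA hj)]
  · rw [coef_add, coef_smul, coef_part_of_notMem _ hj, coef_part_of_notMem _ hj,
      coef_part_of_notMem _ hj, smul_zero, add_zero]

theorem continuous_eval : Continuous fun p : Coeffs n × E n => p.1.eval p.2 := by
  have hpart (A : Set ℤ) : Continuous fun p : Coeffs n × E n => p.2.part A :=
    (partL n A).continuous.comp continuous_snd
  unfold eval plus zero minus
  fun_prop

theorem isBounded_image_eval {B : Set (E n × unitInterval)} (hB : Bornology.IsBounded B)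
    {T : E n × unitInterval → Coeffs n} (hT : IsCompact (closure (T '' B))) :
    Bornology.IsBounded ((fun p => (T p).eval p.1) '' B) := by
  obtain ⟨R, hR⟩ := hT.exists_bound_of_continuousOn
    (f := fun S : Coeffs n => ((S.1 : ℝ), (S.2.1 : ℝ), (S.2.2.1 : ℝ), S.2.2.2))
    (by fun_prop : Continuous _).continuousOn
  obtain ⟨r, hr⟩ := (Bornology.isBounded_image_fst_and_snd.2 hB).1.exists_norm_le
  refine isBounded_iff_forall_norm_le.2 ⟨R * r + R * r + R * r + R, ?_⟩
  rintro _ ⟨p, hp, rfl⟩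
  have hTp := hR _ (subset_closure (mem_image_of_mem T hp))
  simp only [Prod.norm_def, sup_le_iff] at hTp
  obtain ⟨ha, hb, hc, hk⟩ := hTp
  have hsmul (t : ℝ) (A : Set ℤ) (ht : ‖t‖ ≤ R) : ‖t • p.1.part A‖ ≤ R * r := by
    rw [norm_smul]
    exact mul_le_mul ht ((norm_part_le _ _).trans (hr _ (mem_image_of_mem _ hp)))
      (norm_nonneg _) ((norm_nonneg _).trans ht)
  exact norm_add_le_of_le (norm_add_le_of_le (norm_add_le_of_le (hsmul _ _ ha) (hsmul _ _ hb))
    (hsmul _ _ hc)) hk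

/-- The coefficients of the composition of `S.eval` and `T.eval`. -/
noncomputable def comp (S T : Coeffs n) : Coeffs n :=
  (⟨S.1 * T.1, mul_pos (mem_Ioi.1 S.1.2) T.1.2⟩,
    ⟨S.2.1 * T.2.1, mul_pos (mem_Ioi.1 S.2.1.2) T.2.1.2⟩,
    ⟨S.2.2.1 * T.2.2.1, mul_pos (mem_Ioi.1 S.2.2.1.2) T.2.2.1.2⟩, S.eval T.2.2.2)

theorem eval_comp (S T : Coeffs n) (x : E n) : (S.comp T).eval x = S.eval (T.eval x) :=
  ext_coef fun j => by
    simp only [coef_eval, comp]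
    split_ifs <;> module

theorem continuous_comp : Continuous fun p : Coeffs n × Coeffs n => p.1.comp p.2 := by
  have ha : Continuous fun p : Coeffs n × Coeffs n => (p.1.1 * p.2.1 : ℝ) := by fun_prop
  have hb : Continuous fun p : Coeffs n × Coeffs n => (p.1.2.1 * p.2.2.1 : ℝ) := by fun_prop
  have hc : Continuous fun p : Coeffs n × Coeffs n => (p.1.2.2.1 * p.2.2.2.1 : ℝ) := by fun_prop
  have hk : Continuous fun p : Coeffs n × Coeffs n => p.1.eval p.2.2.2.2 :=
    continuous_eval.comp₂ continuous_fst (by fun_prop)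
  exact (ha.subtype_mk _).prodMk ((hb.subtype_mk _).prodMk ((hc.subtype_mk _).prodMk hk))

end Coeffs

theorem isAdmissible_iff {γ : E n → E n} : IsAdmissible γ ↔
    ∃ T : E n × unitInterval → Coeffs n, Continuous T ∧
      (∀ B, Bornology.IsBounded B → IsCompact (closure (T '' B))) ∧
      (∀ x, (T (x, 0)).eval x = x) ∧ (∀ x, (T (x, 1)).eval x = γ x) ∧
      ∀ u, (fun x => (T (x, u)).eval x) '' {x | x.plus ≠ 0} = {x | x.plus ≠ 0} := by
  have hcompl : ((Eminus n ⊔ Ezero n : Submodule ℝ (E n)) : Set (E n))ᶜ = {x | x.plus ≠ 0} :=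
    ext fun x => not_congr mem_Eminus_sup_Ezero_iff
  constructor
  · rintro ⟨-, G, -, h0, h1, himage, a, b, c, K, hT, hB, hG⟩
    have hG' (u) : (fun x => Coeffs.eval (a (x, u), b (x, u), c (x, u), K (x, u)) x) = G u :=
      funext fun x => (hG x u).symm
    refine ⟨fun p => (a p, b p, c p, K p), hT, hB,
      fun x => (hG x 0).symm.trans (congrFun h0 x), fun x => (hG x 1).symm.trans (congrFun h1 x),
      fun u => ?_⟩
    rw [← hcompl, hG']
    exact himage u
  · rintro ⟨T, hT, hB, h0, h1, himage⟩
    have hG : Continuous fun p : E n × unitInterval => (T p).eval p.1 :=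
      Coeffs.continuous_eval.comp₂ hT continuous_fst
    refine ⟨?_, fun u x => (T (x, u)).eval x, hG, funext h0, funext h1, fun u => ?_,
      fun p => (T p).1, fun p => (T p).2.1, fun p => (T p).2.2.1, fun p => (T p).2.2.2, hT, hB,
      fun x u => rfl⟩
    · rw [← funext h1]
      exact hG.comp (continuous_id.prodMk continuous_const)
    · rw [hcompl]
      exact himage u

theorem IsAdmissible.comp {ψ γ : E n → E n} (hψ : IsAdmissible ψ) (hγ : IsAdmissible γ) :
    IsAdmissible (ψ ∘ γ) := by
  obtain ⟨S, hS, hSB, hS0, hS1, hSimage⟩ := isAdmissible_iff.1 hψ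
  obtain ⟨T, hT, hTB, hT0, hT1, hTimage⟩ := isAdmissible_iff.1 hγ
  let q : E n × unitInterval → E n × unitInterval := fun p => ((T p).eval p.1, p.2)
  have hq : Continuous q :=
    (Coeffs.continuous_eval.comp₂ hT continuous_fst).prodMk continuous_snd
  refine isAdmissible_iff.2 ⟨fun p => (S (q p)).comp (T p),
    Coeffs.continuous_comp.comp₂ (hS.comp hq) hT, fun B hB => ?_, fun x => ?_,
    fun x => ?_, fun u => ?_⟩
  · have hqB : Bornology.IsBounded (q '' B) := by
      refine ((Coeffs.isBounded_image_eval hB (hTB B hB)).prod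
        (Bornology.isBounded_image_fst_and_snd.2 hB).2).subset ?_
      rintro _ ⟨p, hp, rfl⟩
      exact ⟨mem_image_of_mem _ hp, p, hp, rfl⟩
    refine (((hSB _ hqB).prod (hTB B hB)).image Coeffs.continuous_comp).closure_of_subset ?_
    rintro _ ⟨p, hp, rfl⟩
    exact ⟨(S (q p), T p), ⟨subset_closure (mem_image_of_mem S (mem_image_of_mem q hp)),
      subset_closure (mem_image_of_mem T hp)⟩, rfl⟩
  · simp only [q, Coeffs.eval_comp, hT0, hS0]
  · simp only [q, Coeffs.eval_comp, hT1, hS1, Function.comp_apply]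
  · simp only [q, Coeffs.eval_comp]
    rw [← image_image (fun y => (S (y, u)).eval y), hTimage, hSimage]

theorem image_setOf_plus_ne_zero {f : E n → E n} (hf : Function.Surjective f)
    (hplus : ∀ x, (f x).plus = 0 ↔ x.plus = 0) : f '' {x | x.plus ≠ 0} = {x | x.plus ≠ 0} := by
  have hpreimage : {x : E n | x.plus ≠ 0} = f ⁻¹' {x | x.plus ≠ 0} :=
    ext fun x => (hplus x).not.symm
  nth_rw 1 [hpreimage]
  exact image_preimage_eq _ hf

theorem isAdmissible_smul_add {ε : ℝ} (hε : 0 < ε) {y : E n} (hy : y.plus = 0) :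
    IsAdmissible fun x : E n => ε • x + y := by
  have hpos (u : unitInterval) : 0 < 1 - (u : ℝ) + u * ε := by
    rcases u.2.1.eq_or_lt with hu | hu
    · rw [← hu, sub_zero, zero_mul, add_zero]
      exact one_pos
    · linarith [u.2.2, mul_pos hu hε]
  let r : unitInterval → Ioi (0 : ℝ) := fun u => ⟨1 - (u : ℝ) + u * ε, hpos u⟩
  have hr : Continuous r := Continuous.subtype_mk (by fun_prop) _
  let T : unitInterval → Coeffs n := fun u => (r u, r u, r u, (u : ℝ) • y)
  have hT : Continuous T := by fun_prop
  have heval (x u) : (T u).eval x = (1 - (u : ℝ) + u * ε) • x + (u : ℝ) • y := by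
    simp only [Coeffs.eval, T, r, ← smul_add, plus_add_zero_add_minus]
  refine isAdmissible_iff.2 ⟨fun p => T p.2, hT.comp continuous_snd, fun B _ => ?_, fun x => ?_,
    fun x => ?_, fun u => ?_⟩
  · refine (isCompact_range hT).closure_of_subset ?_
    rintro _ ⟨p, -, rfl⟩
    exact mem_range_self _
  · simp [heval]
  · simp [heval]
  · simp only [heval]
    refine image_setOf_plus_ne_zero
      (fun z => ⟨(1 - (u : ℝ) + u * ε)⁻¹ • (z - (u : ℝ) • y), ?_⟩) fun x => ?_
    · simp only [smul_inv_smul₀ (hpos u).ne', sub_add_cancel]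
    · rw [plus_add, plus_smul, plus_smul, hy, smul_zero, add_zero, smul_eq_zero]
      exact or_iff_right (hpos u).ne'

end Admissible

section GradientStep

open E
open scoped NNReal

variable {n : ℕ} {H : Phase n → ℝ} {M : ℝ≥0}

/-- The cutoff factor `‖x⁺‖ / (1 + ‖x‖)`. It vanishes on `𝔼⁻ ⊕ 𝔼⁰`, and its decay at infinity in
`‖x - y‖ / (1 + ‖y‖)` makes products with Lipschitz maps Lipschitz. -/
noncomputable def cutoff (x : E n) : ℝ := ‖x.plus‖ / (1 + ‖x‖)

theorem cutoff_nonneg (x : E n) : 0 ≤ cutoff x := by unfold cutoff; positivity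

theorem cutoff_le_one (x : E n) : cutoff x ≤ 1 := by
  rw [cutoff, div_le_one (by positivity)]
  have hplus : ‖x.plus‖ ≤ ‖x‖ := norm_part_le _ x
  linarith

theorem continuous_cutoff : Continuous (cutoff : E n → ℝ) :=
  (partL n {j | 0 < j}).continuous.norm.div (by fun_prop) fun x => by positivity

theorem abs_cutoff_sub_mul_le (x y : E n) :
    |cutoff x - cutoff y| * (1 + ‖y‖) ≤ 2 * ‖x - y‖ := by
  have hsplit : (cutoff x - cutoff y) * (1 + ‖y‖) =
      cutoff x * (‖y‖ - ‖x‖) + (‖x.plus‖ - ‖y.plus‖) := by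
    unfold cutoff
    field_simp
    ring
  have hplus : |‖x.plus‖ - ‖y.plus‖| ≤ ‖x - y‖ := by
    refine (abs_norm_sub_norm_le _ _).trans ?_
    rw [show x.plus - y.plus = (x - y).part _ from (map_sub (partL n _) x y).symm]
    exact norm_part_le _ _
  have hnorm : cutoff x * |‖y‖ - ‖x‖| ≤ ‖x - y‖ :=
    (mul_le_of_le_one_left (abs_nonneg _) (cutoff_le_one x)).trans
      (norm_sub_rev x y ▸ abs_norm_sub_norm_le y x)
  calc |cutoff x - cutoff y| * (1 + ‖y‖) = |(cutoff x - cutoff y) * (1 + ‖y‖)| := by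
        rw [abs_mul, abs_of_pos (by positivity : 0 < 1 + ‖y‖)]
    _ ≤ cutoff x * |‖y‖ - ‖x‖| + |‖x.plus‖ - ‖y.plus‖| := by
        rw [hsplit]
        refine (abs_add_le _ _).trans_eq ?_
        rw [abs_mul, abs_of_nonneg (cutoff_nonneg x)]
    _ ≤ 2 * ‖x - y‖ := by linarith

theorem exists_lipschitzWith_cutoff_smul {G : E n → E n} {K : ℝ≥0} (hG : LipschitzWith K G) :
    ∃ L, LipschitzWith L fun x => cutoff x • G x := by
  refine ⟨K + 2 * (‖G 0‖₊ + K), LipschitzWith.of_dist_le_mul fun x y => ?_⟩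
  have hgrowth : ‖G y‖ ≤ (‖G 0‖ + K) * (1 + ‖y‖) := by
    have h0 := hG.norm_sub_le y 0
    rw [sub_zero] at h0
    nlinarith [norm_le_norm_add_norm_sub' (G y) (G 0), K.coe_nonneg,
      mul_nonneg (norm_nonneg (G 0)) (norm_nonneg y)]
  have hsplit : cutoff x • G x - cutoff y • G y =
      cutoff x • (G x - G y) + (cutoff x - cutoff y) • G y := by module
  have hfirst : ‖cutoff x • (G x - G y)‖ ≤ K * ‖x - y‖ := by
    rw [norm_smul, Real.norm_of_nonneg (cutoff_nonneg x)]
    exact (mul_le_of_le_one_left (norm_nonneg _) (cutoff_le_one x)).trans (hG.norm_sub_le x y)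
  have hsecond : ‖(cutoff x - cutoff y) • G y‖ ≤ 2 * (‖G 0‖ + K) * ‖x - y‖ :=
    calc ‖(cutoff x - cutoff y) • G y‖ = |cutoff x - cutoff y| * ‖G y‖ := norm_smul _ _
      _ ≤ |cutoff x - cutoff y| * ((‖G 0‖ + K) * (1 + ‖y‖)) := by gcongr
      _ = (‖G 0‖ + K) * (|cutoff x - cutoff y| * (1 + ‖y‖)) := by ring
      _ ≤ (‖G 0‖ + K) * (2 * ‖x - y‖) :=
        mul_le_mul_of_nonneg_left (abs_cutoff_sub_mul_le x y) (by positivity)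
      _ = 2 * (‖G 0‖ + K) * ‖x - y‖ := by ring
  rw [dist_eq_norm, dist_eq_norm, hsplit]
  refine (norm_add_le_of_le hfirst hsecond).trans_eq ?_
  push_cast
  ring

/-- An explicit Euler step of length `s` for the gradient flow of `Φ_H`, cut off so that it fixes
`𝔼⁻ ⊕ 𝔼⁰`. -/
noncomputable def gradStep (hM : LipschitzWith M (gradient H)) (s : ℝ) (x : E n) : E n :=
  x + (s * cutoff x) • gradAction hM x

theorem image_gradStep {hM : LipschitzWith M (gradient H)} {L : ℝ≥0}
    (hL : LipschitzWith L fun x : E n => cutoff x • gradAction hM x) {s : ℝ≥0} (hs : s * L < 1) :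
    gradStep hM s '' {x : E n | x.plus ≠ 0} = {x | x.plus ≠ 0} := by
  have hfix (x : E n) (hx : x.plus = 0) : gradStep hM s x = x := by
    rw [gradStep, cutoff, hx, norm_zero, zero_div, mul_zero, zero_smul, add_zero]
  have hlip : LipschitzWith (s * L) fun x : E n => (s * cutoff x : ℝ) • gradAction hM x := by
    refine LipschitzWith.of_dist_le_mul fun x y => ?_
    rw [mul_smul, mul_smul, dist_smul₀, Real.norm_of_nonneg s.coe_nonneg, NNReal.coe_mul, mul_assoc]
    exact mul_le_mul_of_nonneg_left (hL.dist_le_mul x y) s.coe_nonneg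
  have hbij : Function.Bijective (gradStep (n := n) hM s) := bijective_add_of_lipschitzWith hs hlip
  refine image_setOf_plus_ne_zero hbij.2 fun x => ⟨fun hx => ?_, fun hx => ?_⟩
  · rwa [hbij.1 (hfix _ hx)] at hx
  · rwa [hfix x hx]

/-- The coefficients of `x ↦ x + τ (x⁺ - x⁻ - y)`. -/
noncomputable def Coeffs.euler (τ : Icc (0 : ℝ) (1 / 2)) (y : E n) : Coeffs n :=
  (⟨1 + τ, by have := τ.2.1; rw [mem_Ioi]; linarith⟩, ⟨1, mem_Ioi.2 one_pos⟩,
    ⟨1 - τ, by have := τ.2.2; rw [mem_Ioi]; linarith⟩, -((τ : ℝ) • y))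

theorem Coeffs.eval_euler (τ : Icc (0 : ℝ) (1 / 2)) (x y : E n) :
    (Coeffs.euler τ y).eval x = x + (τ : ℝ) • (x.plus - x.minus - y) := by
  conv_rhs => arg 1; rw [← plus_add_zero_add_minus x]
  simp only [Coeffs.eval, Coeffs.euler]
  module

theorem Coeffs.continuous_euler :
    Continuous fun p : Icc (0 : ℝ) (1 / 2) × E n => Coeffs.euler p.1 p.2 :=
  (Continuous.subtype_mk (by fun_prop) _).prodMk (continuous_const.prodMk
    ((Continuous.subtype_mk (by fun_prop) _).prodMk (by fun_prop)))

theorem isAdmissible_gradStep {hM : LipschitzWith M (gradient H)} {L : ℝ≥0}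
    (hL : LipschitzWith L fun x : E n => cutoff x • gradAction hM x) {s : ℝ≥0}
    (hs : s ≤ 1 / 2) (hsL : s * L < 1) : IsAdmissible (gradStep (n := n) hM s) := by
  let τ : E n × unitInterval → Icc (0 : ℝ) (1 / 2) := fun p => ⟨p.2 * (s * cutoff p.1),
    mul_nonneg p.2.2.1 (mul_nonneg s.coe_nonneg (cutoff_nonneg _)),
    (mul_le_of_le_one_left (mul_nonneg s.coe_nonneg (cutoff_nonneg _)) p.2.2.2).trans
      ((mul_le_of_le_one_right s.coe_nonneg (cutoff_le_one _)).trans (by exact_mod_cast hs))⟩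
  let q : E n × unitInterval → Icc (0 : ℝ) (1 / 2) × E n := fun p => (τ p, gradPotential hM p.1)
  have hq : Continuous q := by
    have hcutoff := continuous_cutoff (n := n)
    exact (Continuous.subtype_mk (by fun_prop) _).prodMk
      ((lipschitzWith_gradPotential hM).continuous.comp continuous_fst)
  let T : E n × unitInterval → Coeffs n := fun p => Coeffs.euler (q p).1 (q p).2
  have heval (x : E n) (u : unitInterval) :
      (T (x, u)).eval x = gradStep hM ((Real.toNNReal u * s : ℝ≥0) : ℝ) x := by
    rw [Coeffs.eval_euler, gradStep, gradAction, NNReal.coe_mul, Real.coe_toNNReal _ u.2.1,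
      mul_assoc]
  refine isAdmissible_iff.2 ⟨T, Coeffs.continuous_euler.comp hq, fun B hB => ?_, fun x => ?_,
    fun x => ?_, fun u => ?_⟩
  · have hK :=
      isCompact_closure_image_gradPotential hM (Bornology.isBounded_image_fst_and_snd.2 hB).1
    refine ((isCompact_univ.prod hK).image Coeffs.continuous_euler).closure_of_subset ?_
    rintro _ ⟨p, hp, rfl⟩
    exact ⟨q p, ⟨mem_univ _, subset_closure (mem_image_of_mem _ (mem_image_of_mem _ hp))⟩, rfl⟩
  · simp [heval, gradStep]
  · simp [heval]
  · simp only [heval]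
    refine image_gradStep hL (lt_of_le_of_lt ?_ hsL)
    gcongr
    exact mul_le_of_le_one_left zero_le (Real.toNNReal_le_one.2 u.2.2)

theorem add_le_action_gradStep (hH : Differentiable ℝ H) (hM : LipschitzWith M (gradient H))
    {s : ℝ} (hs : 0 ≤ s) (hsM : s * (M + 1) ≤ 1 / 2) (x : E n) :
    action H x + s * cutoff x * ‖gradAction hM x‖ ^ 2 / 2 ≤ action H (gradStep hM s x) := by
  have hτ : 0 ≤ s * cutoff x := mul_nonneg hs (cutoff_nonneg x)
  have htaylor := (abs_le.1 (abs_action_add_sub_sub_inner_le hH hM x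
    ((s * cutoff x) • gradAction hM x))).1
  rw [real_inner_smul_right, real_inner_self_eq_norm_sq, norm_smul, Real.norm_of_nonneg hτ]
    at htaylor
  have herror : (M + 1) * (s * cutoff x * ‖gradAction hM x‖) ^ 2 ≤
      s * cutoff x * ‖gradAction hM x‖ ^ 2 / 2 :=
    calc (M + 1) * (s * cutoff x * ‖gradAction hM x‖) ^ 2
        = s * (M + 1) * cutoff x * (s * cutoff x * ‖gradAction hM x‖ ^ 2) := by ring
      _ ≤ 1 / 2 * (s * cutoff x * ‖gradAction hM x‖ ^ 2) := by
        gcongr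
        exact (mul_le_of_le_one_right (by positivity) (cutoff_le_one x)).trans hsM
      _ = s * cutoff x * ‖gradAction hM x‖ ^ 2 / 2 := by ring
  rw [gradStep]
  linarith

theorem exists_isAdmissible_add_le_action (hH : Differentiable ℝ H)
    (hM : LipschitzWith M (gradient H)) :
    ∃ s : ℝ, 0 < s ∧ ∃ ψ : E n → E n, IsAdmissible ψ ∧
      ∀ x, action H x + s * cutoff x * ‖gradAction hM x‖ ^ 2 ≤ action H (ψ x) := by
  obtain ⟨L, hL⟩ := exists_lipschitzWith_cutoff_smul (lipschitzWith_gradAction (n := n) hM)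
  obtain ⟨s, hs, hsLM⟩ := exists_pos_mul_lt (one_pos (α := ℝ)) (2 * (M + 1) + L)
  lift s to ℝ≥0 using hs.le
  have hM0 : (0 : ℝ) ≤ s * M := by positivity
  have hL0 : (0 : ℝ) ≤ s * L := by positivity
  have hs_half : (s : ℝ) ≤ (1 / 2 : ℝ≥0) := by push_cast; linarith
  have hsL : (s * L : ℝ) < 1 := by linarith
  refine ⟨s / 2, by positivity, gradStep hM s,
    isAdmissible_gradStep hL (mod_cast hs_half) (mod_cast hsL), fun x => ?_⟩
  have hstep := add_le_action_gradStep hH hM hs.le (by linarith) x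
  linarith

end GradientStep

namespace E

open Filter Topology

variable {n : ℕ}

theorem norm_single_sq (j : ℤ) (v : L0 n) : ‖single j v‖ ^ 2 = weight j * ‖v‖ ^ 2 := by
  rw [← real_inner_self_eq_norm_sq, inner_single_left, coef_single, if_pos rfl,
    real_inner_self_eq_norm_sq, Submodule.coe_norm]

theorem single_ne_zero (j : ℤ) {v : L0 n} (hv : v ≠ 0) : single j v ≠ 0 := by
  rw [← norm_ne_zero_iff, ← pow_ne_zero_iff two_ne_zero, norm_single_sq]
  exact mul_ne_zero (weight_pos j).ne' (pow_ne_zero 2 (norm_ne_zero_iff.2 hv))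

theorem single_mem_supportedOn {A : Set ℤ} {j : ℤ} (hj : j ∈ A) (v : L0 n) :
    single j v ∈ supportedOn n A := fun k hk => by
  rw [coef_single, if_neg (ne_of_mem_of_not_mem hj hk)]

theorem part_eq_zero {A B : Set ℤ} {x : E n} (hx : x ∈ supportedOn n A) (hAB : Disjoint A B) :
    x.part B = 0 := ext_coef fun j => by
  rw [coef_zero]
  by_cases hj : j ∈ B
  · rw [coef_part_of_mem x hj, hx j (hAB.notMem_of_mem_right hj)]
  · exact coef_part_of_notMem x hj

theorem minus_eq_zero {x : E n} (hx : x ∈ Eplus n) : x.minus = 0 :=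
  part_eq_zero hx (disjoint_left.2 fun j (hpos : 0 < j) hneg => lt_asymm hpos hneg)

theorem tendsto_part_of_tendsto {A : ℕ → Set ℤ} {y : ℕ → E n} {z w : E n}
    (hy : Tendsto y atTop (𝓝 z)) (hz : Tendsto (fun k => z.part (A k)) atTop (𝓝 w)) :
    Tendsto (fun k => (y k).part (A k)) atTop (𝓝 w) := by
  have hdiff : Tendsto (fun k => (y k - z).part (A k)) atTop (𝓝 0) :=
    squeeze_zero_norm (fun k => norm_part_le _ _) (tendsto_iff_norm_sub_tendsto_zero.1 hy)
  have hsum := hdiff.add hz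
  simp only [← partL_apply, ← map_add, sub_add_cancel, zero_add] at hsum
  exact hsum

/-- The modes `1, …, N`. -/
def posModes (N : ℕ) : Set ℤ := ↑(lowModes N) ∩ {j | 0 < j}

instance (N : ℕ) : Finite (posModes N) := (lowModes N).finite_toSet.inter_of_left _

theorem tendsto_part_posModes (x : E n) :
    Tendsto (fun N => x.part (posModes N)) atTop (𝓝 x.plus) :=
  ((tendsto_part x.plus).comp tendsto_lowModes).congr fun _ => part_part _ _ x

theorem one_mem_posModes (N : ℕ) : (1 : ℤ) ∈ posModes (N + 1) :=
  ⟨Finset.mem_coe.2 (Finset.mem_Icc.2 (by omega)), Int.one_pos⟩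

end E

section LowerBound

open Topology
open scoped NNReal
open E

variable {n : ℕ} {H : Phase n → ℝ} {M : ℝ≥0}

theorem action_smul_add_single {x : E n} (hx : x ∈ Eplus n) (ε : ℝ) (z : L0 n) :
    action H (ε • x + single 0 z) =
      ε ^ 2 * ‖x‖ ^ 2 / 2 - ∫ t, H ((z : Phase n) + ε • x.toL2 t) := by
  have hz : single 0 z ∈ supportedOn n {0} := single_mem_supportedOn (mem_singleton 0) z
  have hplus : (ε • x + single 0 z).plus = ε • x := by
    rw [plus_add, plus_smul, plus, part_eq_self_iff.2 hx, plus, part_eq_zero hz (by simp), add_zero]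
  have hminus : (ε • x + single 0 z).minus = 0 := by
    rw [minus_add, minus_eq_zero ((Eplus n).smul_mem ε hx), minus, part_eq_zero hz (by simp),
      add_zero]
  have hloop : (ε • x + single 0 z).toL2 =ᵐ[volume] fun t => (z : Phase n) + ε • x.toL2 t := by
    rw [map_add, map_smul, toL2_single]
    filter_upwards [Lp.coeFn_add (ε • toL2 x) (mode n 0 z), Lp.coeFn_smul ε (toL2 x),
      mode_coeFn n 0 z] with t hadd hsmul hmode
    rw [hadd, Pi.add_apply, hsmul, hmode, Pi.smul_apply, add_comm]
    simp [rot]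
  have hint : ∫ t, H ((ε • x + single 0 z).toL2 t) = ∫ t, H ((z : Phase n) + ε • x.toL2 t) :=
    integral_congr_ae (hloop.fun_comp H)
  rw [action, hplus, hminus, hint, norm_smul, norm_zero, mul_pow,
    Real.norm_eq_abs, sq_abs]
  ring

theorem exists_isAdmissible_le_action (hH : Differentiable ℝ H)
    (hM : LipschitzWith M (gradient H))
    (hvanish : (interior (H ⁻¹' {0}) ∩ (L0 n : Set (Phase n))).Nonempty) :
    ∃ β : ℝ, 0 < β ∧ ∃ γ : E n → E n, IsAdmissible γ ∧ ∀ x ∈ Splus n, β ≤ action H (γ x) := by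
  obtain ⟨z, hz, hzL⟩ := hvanish
  have hHz : H =ᶠ[𝓝 z] 0 := mem_interior_iff_mem_nhds.1 hz
  obtain ⟨ε, hε, hint⟩ := exists_integral_add_smul_le hH hM hHz (δ := 1 / 4) (by norm_num)
  refine ⟨ε ^ 2 / 4, by positivity, fun x => ε • x + single 0 ⟨z, hzL⟩,
    isAdmissible_smul_add hε (part_eq_zero (single_mem_supportedOn (mem_singleton 0) _) (by simp)),
    fun x ⟨hx, hx1⟩ => ?_⟩
  rw [action_smul_add_single hx, hx1]
  linarith [hint x hx1.le]

end LowerBound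

section Linking

open Filter Topology
open E

variable {n : ℕ}

theorem exists_part_eval_eq_smul {T : E n × unitInterval → Coeffs n} (hT : Continuous T)
    (hT0 : ∀ x, (T (x, 0)).eval x = x) {A : Set ℤ} [Finite A] {e : E n}
    (heA : e ∈ supportedOn n A) (he : e ≠ 0) :
    ∃ x ∈ supportedOn n A, ‖x‖ = 1 ∧ ∃ (u : unitInterval) (s : ℝ), s * (1 - u) = 0 ∧
      ((T (x, u)).eval x).part A = s • e := by
  by_contra! hcon
  let V := supportedOn n A
  let f : V × ℝ → V := fun p =>
    ⟨((T ((p.1 : E n), projIcc 0 1 zero_le_one p.2)).eval p.1).part A, part_mem_supportedOn A _⟩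
  have hf : Continuous f := by
    refine Continuous.subtype_mk ((partL n A).continuous.comp ?_) _
    refine Coeffs.continuous_eval.comp₂ (hT.comp ?_) (by fun_prop)
    exact (continuous_subtype_val.comp continuous_fst).prodMk
      (continuous_projIcc.comp continuous_snd)
  have hf0 (x : V) (_ : ‖x‖ = 1) : f (x, 0) = x := Subtype.ext <| by
    have h0 : projIcc (0 : ℝ) 1 zero_le_one 0 = 0 := projIcc_left _
    simp only [f, h0, hT0]
    exact part_eq_self_iff.2 x.2
  have hfne (x : V) (hx : ‖x‖ = 1) (u : ℝ) (hu : u ∈ Icc (0 : ℝ) 1) : f (x, u) ≠ 0 := fun h0 => by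
    refine hcon x x.2 hx ⟨u, hu⟩ 0 (zero_mul _) ?_
    have h := congrArg Subtype.val h0
    simp only [f, projIcc_of_mem zero_le_one hu] at h
    rw [zero_smul]
    exact h
  obtain ⟨x, hx, s, -, hxs⟩ :=
    exists_mem_ray_of_homotopy hf hf0 hfne (e := ⟨e, heA⟩) fun h => he (congrArg Subtype.val h)
  refine hcon x x.2 hx 1 s (by simp) ?_
  have h := congrArg Subtype.val hxs
  simpa [f] using h

/-- The equation determines `x_k = a_k⁻¹ (s_k e - k_k)` on the modes in `A_k`, so that `x_k`
converges as soon as the coefficients do. -/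
theorem exists_tendsto_of_part_eval_eq_smul {A : ℕ → Set ℤ} (hA : ∀ k, A k ⊆ {j | 0 < j})
    (hpart : ∀ z : E n, Tendsto (fun k => z.part (A k)) atTop (𝓝 z.plus)) {x : ℕ → E n}
    (hx : ∀ k, x k ∈ supportedOn n (A k)) {T : ℕ → Coeffs n} {T₀ : Coeffs n}
    (hT : Tendsto T atTop (𝓝 T₀)) {s : ℕ → ℝ} {s₀ : ℝ} (hs : Tendsto s atTop (𝓝 s₀)) {e : E n}
    (heq : ∀ k, ((T k).eval (x k)).part (A k) = s k • e) : ∃ x₀, Tendsto x atTop (𝓝 x₀) := by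
  have ha : Tendsto (fun k => ((T k).1 : ℝ)) atTop (𝓝 (T₀.1 : ℝ)) :=
    ((continuous_subtype_val.comp continuous_fst).tendsto T₀).comp hT
  have hk : Tendsto (fun k => (T k).2.2.2) atTop (𝓝 T₀.2.2.2) :=
    ((by fun_prop : Continuous fun S : Coeffs n => S.2.2.2).tendsto T₀).comp hT
  have hx_eq (k : ℕ) : x k = ((T k).1 : ℝ)⁻¹ • (s k • e - (T k).2.2.2.part (A k)) := by
    rw [← heq, Coeffs.part_eval _ _ (hA k), part_eq_self_iff.2 (hx k), add_sub_cancel_right,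
      inv_smul_smul₀ (mem_Ioi.1 (T k).1.2).ne']
  exact ⟨_, ((ha.inv₀ (mem_Ioi.1 T₀.1.2).ne').smul ((hs.smul_const e).sub
    (tendsto_part_of_tendsto hk (hpart _)))).congr fun k => (hx_eq k).symm⟩

theorem exists_bound_of_part_eval_eq_smul {T : E n × unitInterval → Coeffs n}
    {B : Set (E n × unitInterval)} (hB : Bornology.IsBounded B)
    (hT : IsCompact (closure (T '' B))) {e : E n} (he : e ≠ 0) :
    ∃ R, ∀ p ∈ B, ∀ (A : Set ℤ) (s : ℝ), ((T p).eval p.1).part A = s • e → |s| ≤ R := by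
  obtain ⟨R, hR⟩ := (Coeffs.isBounded_image_eval hB hT).exists_norm_le
  refine ⟨R / ‖e‖, fun p hp A s heq => (le_div_iff₀ (norm_pos_iff.2 he)).2 ?_⟩
  rw [← Real.norm_eq_abs, ← norm_smul, ← heq]
  exact (norm_part_le _ _).trans (hR _ (mem_image_of_mem _ hp))

theorem exists_plus_eval_eq_smul {T : E n × unitInterval → Coeffs n} (hT : Continuous T)
    (hTB : ∀ B, Bornology.IsBounded B → IsCompact (closure (T '' B)))
    (hT0 : ∀ x, (T (x, 0)).eval x = x) {v : L0 n} (hv : v ≠ 0) :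
    ∃ x ∈ Splus n, ∃ (u : unitInterval) (s : ℝ), s * (1 - u) = 0 ∧
      ((T (x, u)).eval x).plus = s • single 1 v := by
  choose x hxA hx1 u s hsu heq using fun N =>
    exists_part_eval_eq_smul hT hT0 (single_mem_supportedOn (one_mem_posModes N) v)
      (single_ne_zero 1 hv)
  have hB : Bornology.IsBounded (Metric.sphere (0 : E n) 1 ×ˢ (univ : Set unitInterval)) :=
    Metric.isBounded_sphere.prod isCompact_univ.isBounded
  have hxB (N : ℕ) : (x N, u N) ∈ Metric.sphere (0 : E n) 1 ×ˢ univ :=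
    ⟨mem_sphere_zero_iff_norm.2 (hx1 N), mem_univ _⟩
  obtain ⟨R, hR⟩ := exists_bound_of_part_eval_eq_smul hB (hTB _ hB) (single_ne_zero 1 hv)
  obtain ⟨⟨T₀, u₀, s₀⟩, -, φ, hφ, hlim⟩ :=
    ((hTB _ hB).prod ((isCompact_univ (X := unitInterval)).prod
      (isCompact_Icc (a := -R) (b := R)))).tendsto_subseq
      (x := fun N => (T (x N, u N), u N, s N))
      fun N => ⟨subset_closure (mem_image_of_mem T (hxB N)), mem_univ (u N),
        abs_le.1 (hR _ (hxB N) _ _ (heq N))⟩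
  have hTφ : Tendsto (fun k => T (x (φ k), u (φ k))) atTop (𝓝 T₀) := hlim.fst_nhds
  have huφ : Tendsto (fun k => u (φ k)) atTop (𝓝 u₀) := hlim.snd_nhds.fst_nhds
  have hsφ : Tendsto (fun k => s (φ k)) atTop (𝓝 s₀) := hlim.snd_nhds.snd_nhds
  have hpart (z : E n) : Tendsto (fun k => z.part (posModes (φ k + 1))) atTop (𝓝 z.plus) :=
    (tendsto_part_posModes z).comp ((tendsto_add_atTop_nat 1).comp hφ.tendsto_atTop)
  obtain ⟨x₀, hx₀⟩ := exists_tendsto_of_part_eval_eq_smul (fun _ => inter_subset_right) hpart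
    (fun k => hxA (φ k)) hTφ hsφ fun k => heq (φ k)
  have hx₀plus : x₀.plus = x₀ := tendsto_nhds_unique (tendsto_part_of_tendsto hx₀ (hpart x₀))
    (hx₀.congr fun k => (part_eq_self_iff.2 (hxA (φ k))).symm)
  have heval : Tendsto (fun k => (T (x (φ k), u (φ k))).eval (x (φ k))) atTop
      (𝓝 ((T (x₀, u₀)).eval x₀)) :=
    ((Coeffs.continuous_eval.comp₂ hT continuous_fst).tendsto _).comp (hx₀.prodMk_nhds huφ)
  refine ⟨x₀, ⟨part_eq_self_iff.1 hx₀plus, tendsto_nhds_unique hx₀.norm ?_⟩, u₀, s₀,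
    tendsto_nhds_unique (hsφ.mul ((continuous_subtype_val.tendsto u₀).comp huφ |>.const_sub 1)) ?_,
    tendsto_nhds_unique (tendsto_part_of_tendsto heval (hpart _)) ?_⟩
  · simp only [hx1, tendsto_const_nhds]
  · simp only [Function.comp_apply, hsu, tendsto_const_nhds]
  · simp only [heq]
    exact hsφ.smul_const _

theorem IsAdmissible.exists_plus_eq_smul {γ : E n → E n} (hγ : IsAdmissible γ) {v : L0 n}
    (hv : v ≠ 0) : ∃ x ∈ Splus n, ∃ s : ℝ, (γ x).plus = s • single 1 v := by
  obtain ⟨T, hT, hTB, hT0, hT1, himage⟩ := isAdmissible_iff.1 hγ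
  obtain ⟨x, hx, u, s, hsu, heq⟩ := exists_plus_eval_eq_smul hT hTB hT0 hv
  have hs0 : s ≠ 0 := fun hs0 => by
    have hxplus : x.plus ≠ 0 := by
      rw [plus, part_eq_self_iff.2 hx.1, ← norm_ne_zero_iff, hx.2]
      exact one_ne_zero
    refine (himage u).subset (mem_image_of_mem _ hxplus) ?_
    rw [heq, hs0, zero_smul]
  have hu : u = 1 := Subtype.ext (sub_eq_zero.1 ((mul_eq_zero.1 hsu).resolve_left hs0)).symm
  exact ⟨x, hx, s, by rw [← hT1, ← hu, heq]⟩

end Linking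

section Minimax

open E
open scoped NNReal

variable {n : ℕ} {H : Phase n → ℝ} {M : ℝ≥0}

/-- This is where the slope bound `a > π` enters: the mode `1` contributes
`½ ‖x⁺‖² = π ‖x_1‖² ≤ π ‖x‖²_{L²}`. -/
theorem action_le_of_plus_eq_smul (hH : Differentiable ℝ H) (hM : LipschitzWith M (gradient H))
    {D : ℝ} (hD : ∀ z, Real.pi * ‖z‖ ^ 2 - D ≤ H z) {x : E n} {v : L0 n} {s : ℝ}
    (hx : x.plus = s • single 1 v) : action H x ≤ D := by
  have hcoef : x.coef 1 = s • (v : Phase n) := by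
    rw [← coef_part_of_mem x (show (1 : ℤ) ∈ {j | 0 < j} from Int.one_pos),
      show x.part {j | 0 < j} = s • single 1 v from hx, coef_smul, coef_single, if_pos rfl]
  have hplus : ‖x.plus‖ ^ 2 = 2 * Real.pi * ‖x.coef 1‖ ^ 2 := by
    rw [hx, hcoef, norm_smul, norm_smul, mul_pow, mul_pow, norm_single_sq,
      weight_of_ne one_ne_zero, Submodule.coe_norm, Int.cast_one, abs_one]
    ring
  have hmode : Real.pi * ‖x.coef 1‖ ^ 2 ≤ Real.pi * ‖toL2 x‖ ^ 2 :=
    mul_le_mul_of_nonneg_left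
      (le_hasSum (hasSum_norm_sq_toL2 x) 1 fun _ _ => sq_nonneg _) Real.pi_pos.le
  have hpotential := mul_norm_sq_sub_le_integral hH hM hD (toL2 x)
  rw [action, hplus]
  linarith [sq_nonneg ‖x.minus‖]

theorem exists_L0_ne_zero (hn : 0 < n) : ∃ v : L0 n, v ≠ 0 := by
  refine ⟨⟨EuclideanSpace.single (Sum.inl ⟨0, hn⟩) 1, ?_⟩, fun h => ?_⟩
  · change tau0 n _ = _
    ext i
    rcases i with i | i <;> simp [tau0]
  · simpa using congrArg (fun w : L0 n => ‖(w : Phase n)‖) h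

theorem cEH_le (hn : 0 < n) (hH : Differentiable ℝ H) (hM : LipschitzWith M (gradient H))
    {D : ℝ} (hD : ∀ z, Real.pi * ‖z‖ ^ 2 - D ≤ H z) : cEH H ≤ (D : EReal) := by
  obtain ⟨v, hv⟩ := exists_L0_ne_zero hn
  refine iSup₂_le fun γ hγ => ?_
  obtain ⟨x, hx, s, heq⟩ := IsAdmissible.exists_plus_eq_smul hγ hv
  exact iInf₂_le_of_le (γ x) (mem_image_of_mem γ hx)
    (EReal.coe_le_coe_iff.2 (action_le_of_plus_eq_smul hH hM hD heq))

theorem coe_le_cEH {γ : E n → E n} (hγ : IsAdmissible γ) {r : ℝ}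
    (hr : ∀ x ∈ Splus n, r ≤ action H (γ x)) : (r : EReal) ≤ cEH H :=
  le_iSup₂_of_le γ hγ (le_iInf₂ (forall_mem_image.2 fun x hx => EReal.coe_le_coe_iff.2 (hr x hx)))

theorem exists_isAdmissible_of_coe_lt_cEH {r : ℝ} (hr : (r : EReal) < cEH H) :
    ∃ γ : E n → E n, IsAdmissible γ ∧ ∀ x ∈ Splus n, r ≤ action H (γ x) := by
  obtain ⟨γ, hlt⟩ := lt_iSup_iff.1 hr
  obtain ⟨hγ, hlt⟩ := lt_iSup_iff.1 hlt
  exact ⟨γ, hγ, fun x hx =>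
    EReal.coe_le_coe_iff.1 (hlt.le.trans (iInf₂_le (γ x) (mem_image_of_mem γ hx)))⟩

theorem exists_le_cutoff (hH : Differentiable ℝ H) (hM : LipschitzWith M (gradient H))
    (hnonneg : ∀ z, 0 ≤ H z) {b D : ℝ} (hb : 0 < b) (hD : ∀ z, b * ‖z‖ ^ 2 - D ≤ H z) {c : ℝ}
    (hc : 0 < c) : ∃ κ > 0, ∀ x : E n, c ≤ action H x → κ ≤ cutoff x := by
  let K : ℝ := 1 / c + 4 + 1 / b + |D| / (b * c)
  have hK : 0 < K := by positivity
  refine ⟨(√K)⁻¹, by positivity, fun x hx => ?_⟩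
  have hlevel : 2 * c + ‖x.minus‖ ^ 2 + 2 * ∫ t, H (toL2 x t) ≤ ‖x.plus‖ ^ 2 := by
    rw [action] at hx
    linarith
  have hintegral : 0 ≤ ∫ t, H (toL2 x t) := integral_nonneg fun t => hnonneg _
  have hplus : 2 * c ≤ ‖x.plus‖ ^ 2 := by linarith [sq_nonneg ‖x.minus‖]
  have hzero : ‖x.zero‖ ^ 2 ≤ (‖x.plus‖ ^ 2 / 2 + |D|) / b := by
    have hpotential := mul_norm_sq_sub_le_integral hH hM hD (toL2 x)
    rw [le_div_iff₀ hb, mul_comm]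
    calc b * ‖x.zero‖ ^ 2 ≤ b * ‖toL2 x‖ ^ 2 := by gcongr; exact norm_zero_le_norm_toL2 x
      _ ≤ ‖x.plus‖ ^ 2 / 2 + |D| := by linarith [sq_nonneg ‖x.minus‖, le_abs_self D]
  have hnorm : (1 + ‖x‖) ^ 2 ≤ K * ‖x.plus‖ ^ 2 :=
    calc (1 + ‖x‖) ^ 2 ≤ 2 + 2 * ‖x‖ ^ 2 := by linarith [sq_nonneg (1 - ‖x‖)]
      _ ≤ 2 + 4 * ‖x.plus‖ ^ 2 + 2 * ((‖x.plus‖ ^ 2 / 2 + |D|) / b) := by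
        rw [norm_sq_eq]
        linarith
      _ = 4 * ‖x.plus‖ ^ 2 + 1 / b * ‖x.plus‖ ^ 2 + (1 / c + |D| / (b * c)) * (2 * c) := by
        field_simp
        ring
      _ ≤ 4 * ‖x.plus‖ ^ 2 + 1 / b * ‖x.plus‖ ^ 2 + (1 / c + |D| / (b * c)) * ‖x.plus‖ ^ 2 := by
        gcongr
      _ = K * ‖x.plus‖ ^ 2 := by ring
  rw [cutoff, le_div_iff₀ (by positivity), inv_mul_le_iff₀ (by positivity)]
  refine le_of_sq_le_sq ?_ (by positivity)
  rwa [mul_pow, Real.sq_sqrt hK.le]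

theorem AsymptoticallyQuadratic.exists_isAdmissible_forall_le_action {C a : ℝ}
    (hH : AsymptoticallyQuadratic H M C a) (hnonneg : ∀ z, 0 ≤ H z) (ha : 0 < a)
    (hres : ∀ k : ℤ, a ≠ k * Real.pi) {c : ℝ} (hc : 0 < c) (hcrit : ¬ IsCriticalValue H c) :
    ∃ η > 0, ∃ ψ : E n → E n, IsAdmissible ψ ∧
      ∀ x, c - η ≤ action H x → c + η ≤ action H (ψ x) := by
  have hM := hH.lipschitz_gradient
  obtain ⟨ε, hε, hgrad⟩ := hH.exists_le_norm_gradAction hres hcrit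
  obtain ⟨D, hD⟩ := hH.exists_mul_norm_sq_sub_le (half_lt_self ha)
  obtain ⟨κ, hκ, hcutoff⟩ :=
    exists_le_cutoff hH.differentiable hM hnonneg (half_pos ha) hD (half_pos hc)
  obtain ⟨s, hs, ψ, hψ, hstep⟩ := exists_isAdmissible_add_le_action hH.differentiable hM
  let η : ℝ := min (min (ε / 2) (c / 2)) (s * κ * ε ^ 2 / 2)
  have hηε : η ≤ ε / 2 := (min_le_left _ _).trans (min_le_left _ _)
  have hηc : η ≤ c / 2 := (min_le_left _ _).trans (min_le_right _ _)
  have hηgain : η ≤ s * κ * ε ^ 2 / 2 := min_le_right _ _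
  have hη : 0 < η := by positivity
  refine ⟨η, hη, ψ, hψ, fun x hx => (hstep x).trans' ?_⟩
  rcases lt_or_ge (action H x) (c + η) with hlt | hge
  · have hx_nonneg := cutoff_nonneg x
    have hx_grad : ε ≤ ‖gradAction hM x‖ :=
      hgrad x (abs_lt.2 ⟨by linarith, by linarith⟩)
    have hx_cutoff : κ ≤ cutoff x := hcutoff x (by linarith)
    have hgain : s * κ * ε ^ 2 ≤ s * cutoff x * ‖gradAction hM x‖ ^ 2 := by gcongr
    linarith
  · have hgain : 0 ≤ s * cutoff x * ‖gradAction hM x‖ ^ 2 :=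
      mul_nonneg (mul_nonneg hs.le (cutoff_nonneg x)) (sq_nonneg _)
    linarith

end Minimax

end SymEH

open scoped NNReal in
theorem theorem3p1_general {n : ℕ} (hn : 0 < n) {H : SymEH.Phase n → ℝ} {M : ℝ≥0} {C a : ℝ}
    (hH : SymEH.AsymptoticallyQuadratic H M C a) (hnonneg : ∀ z, 0 ≤ H z)
    (hvanish : (interior (H ⁻¹' {0}) ∩ (SymEH.L0 n : Set (SymEH.Phase n))).Nonempty)
    (ha : Real.pi < a) (hres : ∀ k : ℤ, a ≠ k * Real.pi) :
    ∃ c : ℝ, SymEH.cEH H = (c : EReal) ∧ 0 < c ∧ SymEH.IsCriticalValue H c := by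
  have hM := hH.lipschitz_gradient
  obtain ⟨D, hD⟩ := hH.exists_mul_norm_sq_sub_le ha
  obtain ⟨β, hβ, γ₀, hγ₀, hlow⟩ :=
    SymEH.exists_isAdmissible_le_action hH.differentiable hM hvanish
  have hupper := SymEH.cEH_le hn hH.differentiable hM hD
  have hlower := SymEH.coe_le_cEH hγ₀ hlow
  obtain ⟨c, hc⟩ : ∃ c : ℝ, (c : EReal) = SymEH.cEH H :=
    ⟨_, EReal.coe_toReal (ne_top_of_le_ne_top (EReal.coe_ne_top D) hupper)
      (ne_bot_of_le_ne_bot (EReal.coe_ne_bot β) hlower)⟩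
  have hc0 : 0 < c := hβ.trans_le (EReal.coe_le_coe_iff.1 (hc ▸ hlower))
  refine ⟨c, hc.symm, hc0, by_contra fun hcrit => ?_⟩
  obtain ⟨η, hη, ψ, hψ, hraise⟩ :=
    hH.exists_isAdmissible_forall_le_action hnonneg (Real.pi_pos.trans ha) hres hc0 hcrit
  obtain ⟨γ, hγ, hγc⟩ := SymEH.exists_isAdmissible_of_coe_lt_cEH (r := c - η)
    (hc ▸ EReal.coe_lt_coe_iff.2 (sub_lt_self c hη))
  have hψγ : ((c + η : ℝ) : EReal) ≤ SymEH.cEH H :=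
    SymEH.coe_le_cEH (hψ.comp hγ) fun x hx => hraise _ (hγc x hx)
  rw [← hc, EReal.coe_le_coe_iff] at hψγ
  linarith

theorem theorem3p1 (n : ℕ) (hn : 0 < n) (H : SymEH.Phase n → ℝ)
    (hsmooth : ContDiff ℝ ∞ H)
    (hnonneg : ∀ z, 0 ≤ H z)
    (hsymm : ∀ z, H z = H (SymEH.tau0 n z))
    (hvanish : (interior (H ⁻¹' {0}) ∩ (SymEH.L0 n : Set (SymEH.Phase n))).Nonempty)
    (hquad : SymEH.QuadraticAtInfinity H)
    (hnonres : SymEH.Nonresonant H) :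
    ∃ c : ℝ, SymEH.cEH H = (c : EReal) ∧ 0 < c ∧ SymEH.IsCriticalValue H c := by
  obtain ⟨z₀, -, a, b, ha, hres, hH⟩ := hnonres
  obtain ⟨M, C, hHM⟩ := SymEH.exists_asymptoticallyQuadratic (contDiff_infty.1 hsmooth 2) hH
  exact theorem3p1_general hn hHM hnonneg hvanish (by linarith [Real.pi_pos]) hres
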